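/- Let $q$ be an odd prime power. For an irreducible polynomial $F\in\mathbb F_q[T]$ of degree $r$ and $x\in\mathbb F_q[T]$, let $\deg_F x$ denote the degree of the unique polynomial of degree less than $r$ that is congruent to $x$ modulo $F$ (with $\deg 0=-\infty$). For a non-negative integer $m\le r$ let $E^{\sqrt{}}_{F,4}(\mathbf 1_m)$ be the number of tuples $(x_1,\dots,x_8)\in\mathbb F_q[T]^8$ with $\deg x_i<r$ and $\deg_F(x_i^2)<m$ for all $i$, and $$x_1+x_2+x_3+x_4\equiv x_5+x_6+x_7+x_8 \pmod F;$$ equivalently, it is the weighted energy $\sum \alpha(x_1^2)\overline{\alpha(x_2^2)}\cdots\alpha(x_7^2)\overline{\alpha(x_8^2)}$, over all $(x_1,\dots,x_8)$ with $\deg x_i<r$ that satisfy this congruence, of the characteristic function $\alpha=\mathbf 1_m$ of the set of residues $x$ modulo $F$ with $\deg_F x<m$. Then $$E^{\sqrt{}}_{F,4}(\mathbf 1_m)\le q^{6m+o(m)}\left(q^{11m/2-r/2}+q^{3m-r/4}+q^{5m/8-r/8}\right)+q^{5m+o(m)},$$ where $o(m)$ denotes a function of $m$ which may depend on $q$, but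 not on $r$ or $F$, and whose quotient by $m$ tends to $0$ as $m\to\infty$. Moreover, for $0<m<r/12$ the exponents in this bound improve on those in the bound $q^{4m+o(m)}\left(q^{7m/2-r/2}+q^{2m}\right)$ for the same quantity: $$\max\left\{6m+\max\left\{\tfrac{11m}{2}-\tfrac r2,\;3m-\tfrac r4,\;\tfrac{5m}{8}-\tfrac r8\right\},\;5m\right\}<4m+\max\left\{\tfrac{7m}{2}-\tfrac r2,\;2m\right\}.$$ -/

import Mathlib

open Polynomial Filter Asymptotics

namespace ModularRoots

noncomputable section

/-- The set of polynomials over `K` of degree smaller than `m` (the zero polynomial has degree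
`⊥`, so it always belongs to this set). -/
def shortPolys (K : Type*) [Field K] (m : ℕ) : Set K[X] :=
  {x | x.degree < (m : WithBot ℕ)}

/-- The residue ring `K[T]/⟨F⟩`. -/
abbrev Residues {K : Type*} [Field K] (F : K[X]) : Type _ :=
  K[X] ⧸ Ideal.span {F}

/-- The quotient map `K[T] → K[T]/⟨F⟩`. -/
abbrev residue {K : Type*} [Field K] (F : K[X]) : K[X] →+* Residues F :=
  Ideal.Quotient.mk (Ideal.span {F})

/-- `deg_F x`: the degree of the representative of `x` modulo `F` of degree less than `deg F`. -/
def degMod {K : Type*} [Field K] (F x : K[X]) : WithBot ℕ :=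
  (x % F).degree

/-- The tuples `(x₁, …, x₂ₖ)` of polynomials of degree less than `deg F` with
`x₁ + ⋯ + xₖ ≡ xₖ₊₁ + ⋯ + x₂ₖ` modulo `F`; the indices here start at `0`. -/
def energyTuples {K : Type*} [Field K] (F : K[X]) (k : ℕ) : Set (Fin (2 * k) → K[X]) :=
  {x | (∀ i, x i ∈ shortPolys K F.natDegree) ∧
    residue F (∑ i with i.val < k, x i) = residue F (∑ i with k ≤ i.val, x i)}

/-- The weighted energy of modular square roots: the sum over the tuples of `energyTuples F k` of
`α(x₁²) conj(α(x₂²)) ⋯ α(x₂ₖ₋₁²) conj(α(x₂ₖ²))`. The set of tuples is finite when `K` is, so that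
the `finsum` is then a genuine finite sum. -/
def sqrtEnergy {K 𝕜 : Type*} [Field K] [RCLike 𝕜] (F : K[X]) (k : ℕ) (α : Residues F → 𝕜) : 𝕜 :=
  ∑ᶠ x ∈ energyTuples F k, ∏ i : Fin (2 * k),
    if Even i.val then α (residue F (x i ^ 2)) else star (α (residue F (x i ^ 2)))

/-- The characteristic function of the set of residues `x` with `deg_F x < m`. -/
def shortWeight {K : Type*} [Field K] (𝕜 : Type*) [RCLike 𝕜] (F : K[X]) (m : ℕ) :
    Residues F → 𝕜 :=
  Set.indicator (residue F '' {x | degMod F x < (m : WithBot ℕ)}) 1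

theorem residue_eq_iff {K : Type*} [Field K] (F x y : K[X]) :
    residue F x = residue F y ↔ x % F = y % F := by
  rw [Ideal.Quotient.mk_eq_mk_iff_sub_mem, Ideal.mem_span_singleton]
  constructor
  · intro h
    rw [← sub_eq_zero, ← Polynomial.sub_mod]
    exact (EuclideanDomain.mod_eq_zero).2 h
  · intro h
    rw [← EuclideanDomain.mod_eq_zero, Polynomial.sub_mod, h, sub_self]

theorem residue_mem_iff {K : Type*} [Field K] (F x : K[X]) (m : ℕ) :
    residue F x ∈ residue F '' {x | degMod F x < (m : WithBot ℕ)} ↔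
      degMod F x < (m : WithBot ℕ) := by
  constructor
  · rintro ⟨y, hy, hxy⟩
    have h := (residue_eq_iff F y x).1 hxy
    change (y % F).degree < (m : WithBot ℕ) at hy
    rwa [h] at hy
  · intro h
    exact ⟨x, h, rfl⟩

theorem finite_shortPolys (K : Type*) [Field K] [Finite K] (m : ℕ) :
    (shortPolys K m).Finite := by
  have h : Finite (degreeLT K m) := Finite.of_equiv _ (degreeLTEquiv K m).toEquiv.symm
  refine (Set.toFinite (degreeLT K m : Set K[X])).subset fun x hx => ?_
  exact mem_degreeLT.2 hx

theorem finite_energyTuples {K : Type*} [Field K] [Finite K] (F : K[X]) (k : ℕ) :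
    (energyTuples F k).Finite := by
  refine (Set.Finite.pi' fun _ : Fin (2 * k) => finite_shortPolys K F.natDegree).subset ?_
  intro x hx
  exact hx.1

/-- For the characteristic function of `deg_F x < m`, the energy is the number of tuples all of
whose entries satisfy `deg_F (xᵢ²) < m`. -/
theorem sqrtEnergy_shortWeight {K : Type*} [Field K] [Finite K] (𝕜 : Type*) [RCLike 𝕜]
    (F : K[X]) (k m : ℕ) :
    sqrtEnergy F k (shortWeight 𝕜 F m) =
      (({x ∈ energyTuples F k | ∀ i, degMod F (x i ^ 2) < (m : WithBot ℕ)}).ncard : 𝕜) := by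
  classical
  have hprod : ∀ x : Fin (2 * k) → K[X], (∏ i : Fin (2 * k),
      if Even i.val then shortWeight 𝕜 F m (residue F (x i ^ 2))
        else star (shortWeight 𝕜 F m (residue F (x i ^ 2)))) =
      if ∀ i, degMod F (x i ^ 2) < (m : WithBot ℕ) then (1 : 𝕜) else 0 := by
    intro x
    trans ∏ i : Fin (2 * k), if degMod F (x i ^ 2) < (m : WithBot ℕ) then (1 : 𝕜) else 0
    · refine Finset.prod_congr rfl fun i _ => ?_
      by_cases h : degMod F (x i ^ 2) < (m : WithBot ℕ)
      · have h1 : shortWeight 𝕜 F m (residue F (x i ^ 2)) = 1 := by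
          rw [shortWeight, Set.indicator_of_mem ((residue_mem_iff F _ m).2 h)]
          rfl
        rw [h1, if_pos h]
        simp
      · have h1 : shortWeight 𝕜 F m (residue F (x i ^ 2)) = 0 := by
          rw [shortWeight, Set.indicator_of_notMem (mt (residue_mem_iff F _ m).1 h)]
        rw [h1, if_neg h]
        simp
    · rw [Fintype.prod_ite_zero, Finset.prod_const_one]
      congr
  rw [sqrtEnergy]
  simp_rw [hprod]
  rw [finsum_mem_eq_finite_toFinset_sum _ (finite_energyTuples F k), Finset.sum_ite,
    Finset.sum_const_zero, add_zero, Finset.sum_const, nsmul_eq_mul, mul_one,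
    ← Set.ncard_coe_finset]
  congr 2
  ext x
  simp

end

end ModularRoots

/-!
Let `X` be the set of residues modulo `F` whose square is represented by a polynomial of degree less
than `m`. Each further summand costs at most a factor `|X|²`, so the energies of sums of one, two
and three elements of `X` control that of sums of four. These are bounded through the number of
representations of an element as such a sum, apart from the few tuples in which the squares of two
entries are represented by polynomials in the same square class.

If `a ^ 2` and `b ^ 2` are represented by `n₁` and `n₂` in different square classes, then `a + b`
determines `n₁ + n₂` and `n₁ * n₂`: otherwise `(a + b) ^ 2` would satisfy a linear equation with
short coefficients besides its quadratic one, and `n₁ * n₂` would be a square.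

For three summands with squares in distinct square classes, `z = (a + b + c) ^ 2` is a root modulo
`F` of the monic quartic over `K[T]` with roots `(√n₁ ± √n₂ ± √n₃) ^ 2`, which is irreducible and
determines the set of the `nᵢ`. The difference of two such quartics is a cubic vanishing at `z`.
Determinants of Sylvester type show that the cubics of small weighted degree vanishing at `z` are
all proportional, and that those of weighted degree at most `4 * m` form a space of dimension at
most `2 * e`, about `(15 * m - r) / 3`, modulo a line. On a line there are at most four quartics of
the given shape, because their coefficients satisfy `(4c₂ - c₃²) ^ 2 = 64c₀`.
-/

namespace ModularRoots

section Twist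

variable {R : Type*} [CommRing R] {m : ℕ}

/-- The substitution `f(T, X) ↦ f(T, T ^ m X)`, followed by an exchange of the two variables: the
outer variable of the result is `T`. -/
noncomputable def twist (R : Type*) [CommRing R] (m : ℕ) : R[X][X] →ₐ[R] R[X][X] :=
  (Bivariate.swap : R[X][X] ≃ₐ[R] R[X][X]).toAlgHom.comp
    ((aeval (C (X ^ m) * X : R[X][X])).restrictScalars R)

/-- The degree in `T` of `f(T, T ^ m X)`, which is the weighted degree of `f` for the weights `1`
of `T` and `m` of `X`. -/
noncomputable def wdeg (m : ℕ) (f : R[X][X]) : ℕ :=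
  (twist R m f).natDegree

theorem twist_monomial (m n : ℕ) (p : R[X]) :
    twist R m (monomial n p) = p.map C * C (X ^ n) * X ^ (n * m) := by
  have h : twist R m (monomial n p) = Bivariate.swap (C p * (C (X ^ m) * X) ^ n) := by
    rw [← C_mul_X_pow_eq_monomial]
    simp [twist, Polynomial.algebraMap_eq]
  have hX : Bivariate.swap (C (X : R[X])) = X := Bivariate.swap_X
  rw [h]
  simp only [map_mul, map_pow, hX, Bivariate.swap_C, Bivariate.swap_Y]
  ring

theorem coeff_coeff_twist (f : R[X][X]) (t j : ℕ) :
    ((twist R m f).coeff t).coeff j =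
      if j * m ≤ t then (f.coeff j).coeff (t - j * m) else 0 := by
  induction f using Polynomial.induction_on' with
  | add f g hf hg => simp only [map_add, coeff_add, hf, hg, ite_add_ite, add_zero]
  | monomial n a =>
    rw [twist_monomial, coeff_mul_X_pow', coeff_monomial]
    obtain rfl | hj := eq_or_ne n j
    · rw [if_pos rfl]
      split_ifs
      · rw [coeff_mul_C, coeff_map, coeff_C_mul, coeff_X_pow_self, mul_one]
      · rw [coeff_zero]
    · rw [if_neg hj, coeff_zero, ite_self]
      split_ifs
      · rw [coeff_mul_C, coeff_map, coeff_C_mul, coeff_X_pow, if_neg hj.symm, mul_zero]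
      · rw [coeff_zero]

theorem coeff_coeff_twist_add (f : R[X][X]) (t j : ℕ) :
    ((twist R m f).coeff (t + j * m)).coeff j = (f.coeff j).coeff t := by
  rw [coeff_coeff_twist, if_pos (Nat.le_add_left _ _), Nat.add_sub_cancel]

theorem twist_injective : Function.Injective (twist R m) := by
  rw [injective_iff_map_eq_zero]
  intro f hf
  ext j t
  rw [← coeff_coeff_twist_add (m := m), hf]
  simp only [coeff_zero]

theorem twist_ne_zero {f : R[X][X]} (hf : f ≠ 0) : twist R m f ≠ 0 :=
  (map_ne_zero_iff _ twist_injective).2 hf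

theorem twist_C (m : ℕ) (p : R[X]) : twist R m (C p) = p.map C := by
  simpa using twist_monomial m 0 p

@[simp]
theorem wdeg_C (p : R[X]) : wdeg m (C p) = p.natDegree := by
  rw [wdeg, twist_C, natDegree_map_eq_of_injective C_injective]

theorem natDegree_coeff_add_le_wdeg (f : R[X][X]) {j : ℕ} (hj : f.coeff j ≠ 0) :
    (f.coeff j).natDegree + j * m ≤ wdeg m f := by
  refine le_natDegree_of_ne_zero fun h => hj ?_
  rw [← leadingCoeff_eq_zero, leadingCoeff, ← coeff_coeff_twist_add (m := m), h, coeff_zero]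

theorem natDegree_mul_le_wdeg (f : R[X][X]) : f.natDegree * m ≤ wdeg m f := by
  obtain rfl | hf := eq_or_ne f 0
  · simp
  · exact (Nat.le_add_left _ _).trans
      (natDegree_coeff_add_le_wdeg f (leadingCoeff_ne_zero.2 hf))

theorem wdeg_le_iff {f : R[X][X]} {s : ℕ} :
    wdeg m f ≤ s ↔ ∀ j, f.coeff j ≠ 0 → (f.coeff j).natDegree + j * m ≤ s := by
  refine ⟨fun h j hj => (natDegree_coeff_add_le_wdeg f hj).trans h, fun h => ?_⟩
  rw [wdeg, natDegree_le_iff_coeff_eq_zero]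
  intro t ht
  ext j
  rw [coeff_coeff_twist, coeff_zero]
  split_ifs
  · by_cases hj : f.coeff j = 0
    · rw [hj, coeff_zero]
    · exact coeff_eq_zero_of_natDegree_lt (by have := h j hj; omega)
  · rfl

theorem wdeg_X_pow_le (i : ℕ) : wdeg m (X ^ i : R[X][X]) ≤ i * m := by
  refine wdeg_le_iff.2 fun j hj => ?_
  obtain rfl | hji := eq_or_ne j i
  · simp
  · exact absurd (by rw [coeff_X_pow, if_neg hji]) hj

theorem wdeg_mul [IsDomain R] {f g : R[X][X]} (hf : f ≠ 0) (hg : g ≠ 0) :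
    wdeg m (f * g) = wdeg m f + wdeg m g := by
  rw [wdeg, map_mul, natDegree_mul (twist_ne_zero hf) (twist_ne_zero hg), wdeg, wdeg]

end Twist

section Determinant

variable {R : Type*} [CommRing R] [IsDomain R]

theorem natDegree_det_add_le {n : Type*} [Fintype n] [DecidableEq n] {N : Matrix n n R[X]}
    (hN : N.det ≠ 0) (a b : n → ℕ) (h : ∀ i j, N i j ≠ 0 → (N i j).natDegree + b j ≤ a i) :
    N.det.natDegree + ∑ j, b j ≤ ∑ i, a i := by
  have hscale : (N * Matrix.diagonal fun j => X ^ b j).det = N.det * X ^ ∑ j, b j := by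
    rw [Matrix.det_mul, Matrix.det_diagonal, Finset.prod_pow_eq_pow_sum]
  rw [← natDegree_X_pow (R := R) (∑ j, b j), ← natDegree_mul hN (pow_ne_zero _ X_ne_zero),
    ← hscale, Matrix.det_apply]
  refine natDegree_sum_le_of_forall_le _ _ fun σ _ => ?_
  rw [Units.smul_def, ← Equiv.sum_comp σ a]
  refine (natDegree_smul_le _ _).trans ((natDegree_prod_le _ _).trans ?_)
  refine Finset.sum_le_sum fun j _ => ?_
  rw [Matrix.mul_diagonal]
  by_cases h0 : N (σ j) j = 0
  · rw [h0, zero_mul, natDegree_zero]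
    exact Nat.zero_le _
  · rw [natDegree_mul h0 (pow_ne_zero _ X_ne_zero), natDegree_X_pow]
    exact h _ _ h0

omit [IsDomain R] in
theorem eq_zero_of_sum_C_mul_X_pow_eq_zero {n : ℕ} {c : Fin n → R}
    (hc : ∑ i, C (c i) * X ^ (i : ℕ) = 0) : c = 0 := by
  funext i
  simpa [finsetSum_coeff, coeff_C_mul, coeff_X_pow, Fin.val_inj] using
    congrArg (fun P => coeff P (i : ℕ)) hc

theorem linearIndependent_shifts [UniqueFactorizationMonoid R] {f g : R[X]} (hf : f ≠ 0)
    (hfg : IsRelPrime f g) :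
    LinearIndependent R (Fin.append (fun i : Fin g.natDegree => X ^ (i : ℕ) * f)
      fun i : Fin f.natDegree => X ^ (i : ℕ) * g) := by
  rw [Fintype.linearIndependent_iff]
  intro c hc
  rw [Fin.sum_univ_add] at hc
  simp only [Fin.append_left, Fin.append_right, smul_eq_C_mul, ← mul_assoc] at hc
  rw [← Finset.sum_mul, ← Finset.sum_mul] at hc
  set p := ∑ i : Fin g.natDegree, C (c (Fin.castAdd _ i)) * X ^ (i : ℕ)
  set q := ∑ i : Fin f.natDegree, C (c (Fin.natAdd _ i)) * X ^ (i : ℕ) with hq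
  have hq0 : q = 0 := by
    by_contra hne
    have hdvd : f ∣ q :=
      hfg.dvd_of_dvd_mul_right ((dvd_add_right (dvd_mul_left f p)).1 (hc ▸ dvd_zero f))
    have hle : f.degree ≤ q.degree := degree_le_of_dvd hdvd hne
    exact hle.not_gt (degree_eq_natDegree hf ▸ degree_sum_fin_lt _)
  have hp0 : p = 0 := by
    rw [hq0, zero_mul, add_zero] at hc
    exact (mul_eq_zero.1 hc).resolve_right hf
  exact Fin.addCases (congrFun (eq_zero_of_sum_C_mul_X_pow_eq_zero hp0))
    (congrFun (eq_zero_of_sum_C_mul_X_pow_eq_zero hq0))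

end Determinant

section CommonRoot

variable {K L : Type*} [Field K] [Field L] {m r : ℕ} {φ : K[X] →+* L} {z : L}

theorem le_natDegree_of_map_eq_zero (hφ : Set.InjOn φ (shortPolys K r)) {a : K[X]} (ha : φ a = 0)
    (ha0 : a ≠ 0) : r ≤ a.natDegree := by
  by_contra! h
  have hshort : a ∈ shortPolys K r := (natDegree_lt_iff_degree_lt ha0).1 h
  have hzero : (0 : K[X]) ∈ shortPolys K r := by simp [shortPolys]
  exact ha0 (hφ hshort hzero (by rw [ha, map_zero]))

theorem add_le_sum_wdeg (hφ : Set.InjOn φ (shortPolys K r)) {n : ℕ} (hn : 0 < n)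
    {h : Fin n → K[X][X]} (hli : LinearIndependent K[X] h) (hdeg : ∀ i, (h i).natDegree < n)
    (hz : ∀ i, eval₂ φ z (h i) = 0) :
    r + m * ∑ j : Fin n, (j : ℕ) ≤ ∑ i, wdeg m (h i) := by
  set N : Matrix (Fin n) (Fin n) K[X] := Matrix.of fun i j => (h i).coeff j with hN
  have hdet : N.det ≠ 0 := by
    intro h0
    obtain ⟨c, hc, hc0⟩ := Matrix.exists_vecMul_eq_zero_iff.2 h0
    refine hc (funext (Fintype.linearIndependent_iff.1 hli c ?_))
    ext1 j
    simp only [finsetSum_coeff, coeff_smul, coeff_zero]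
    by_cases hj : j < n
    · simpa [Matrix.vecMul, dotProduct, hN] using congrFun hc0 ⟨j, hj⟩
    · refine Finset.sum_eq_zero fun i _ => ?_
      rw [coeff_eq_zero_of_natDegree_lt ((hdeg i).trans_le (not_lt.1 hj)), smul_zero]
  -- the vector `(1, z, z², …)` is in the kernel of the image of `N`
  have hdet0 : φ N.det = 0 := by
    rw [RingHom.map_det, ← Matrix.exists_mulVec_eq_zero_iff]
    refine ⟨fun j => z ^ (j : ℕ), fun h0 => ?_, funext fun i => ?_⟩
    · simpa using congrFun h0 ⟨0, hn⟩
    · have hi := hz i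
      rw [eval₂_eq_sum_range' φ (hdeg i), Finset.sum_range] at hi
      simpa [Matrix.mulVec, dotProduct, hN] using hi
  have hle := natDegree_det_add_le hdet (fun i => wdeg m (h i)) (fun j => j * m)
    fun i j => natDegree_coeff_add_le_wdeg (h i)
  rw [← Finset.sum_mul, mul_comm] at hle
  exact (Nat.add_le_add_right (le_natDegree_of_map_eq_zero hφ hdet0 hdet) _).trans hle

theorem add_mul_le_of_isRelPrime (hφ : Set.InjOn φ (shortPolys K r)) {f g : K[X][X]}
    (hf : f ≠ 0) (hg : g ≠ 0) (hfg : IsRelPrime f g) (hpos : 0 < f.natDegree + g.natDegree)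
    (hzf : eval₂ φ z f = 0) (hzg : eval₂ φ z g = 0) :
    r + m * (f.natDegree * g.natDegree) ≤ g.natDegree * wdeg m f + f.natDegree * wdeg m g := by
  have hX (i : ℕ) : (X ^ i : K[X][X]) ≠ 0 := pow_ne_zero i X_ne_zero
  have hsum {p : K[X][X]} (hp : p ≠ 0) (n : ℕ) : ∑ i : Fin n, wdeg m (X ^ (i : ℕ) * p) ≤
      m * ∑ i : Fin n, (i : ℕ) + n * wdeg m p := by
    calc ∑ i : Fin n, wdeg m (X ^ (i : ℕ) * p)
        ≤ ∑ i : Fin n, (m * (i : ℕ) + wdeg m p) := by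
          refine Finset.sum_le_sum fun i _ => ?_
          rw [wdeg_mul (hX i) hp, mul_comm]
          exact Nat.add_le_add_right (wdeg_X_pow_le _) _
      _ = m * ∑ i : Fin n, (i : ℕ) + n * wdeg m p := by
          simp [Finset.sum_add_distrib, Finset.mul_sum]
  have key := add_le_sum_wdeg (m := m) (z := z) hφ (by omega) (linearIndependent_shifts hf hfg)
    (Fin.addCases
      (fun i => by rw [Fin.append_left, natDegree_mul (hX i) hf, natDegree_X_pow]; omega)
      (fun i => by rw [Fin.append_right, natDegree_mul (hX i) hg, natDegree_X_pow]; omega))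
    (Fin.addCases (fun i => by rw [Fin.append_left, eval₂_mul, hzf, mul_zero])
      (fun i => by rw [Fin.append_right, eval₂_mul, hzg, mul_zero]))
  rw [Fin.sum_univ_add, Fin.sum_univ_add] at key
  simp only [Fin.val_castAdd, Fin.val_natAdd, Fin.append_left, Fin.append_right,
    Finset.sum_add_distrib, Finset.sum_const, Finset.card_univ, Fintype.card_fin, smul_eq_mul]
    at key
  nlinarith [key, hsum hf g.natDegree, hsum hg f.natDegree]

end CommonRoot

section Quartic

variable {R : Type*} [CommRing R]

/-- The polynomial with the roots `(√n₀ ± √n₁ ± √n₂)²`. If `e₁, e₂, e₃` are the elementary symmetric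
functions of `n₀, n₁, n₂`, it is `((X - e₁)² - 4e₂)² - 64e₃X`. -/
noncomputable def quartic (n : Fin 3 → R) : R[X] :=
  ((X - C (n 0 + n 1 + n 2)) ^ 2 - C (4 * (n 0 * n 1 + n 0 * n 2 + n 1 * n 2))) ^ 2 -
    C (64 * (n 0 * n 1 * n 2)) * X

theorem quartic_eq (n : Fin 3 → R) : quartic n =
    X ^ 4 + C (-4 * (n 0 + n 1 + n 2)) * X ^ 3 +
      C (6 * (n 0 + n 1 + n 2) ^ 2 - 8 * (n 0 * n 1 + n 0 * n 2 + n 1 * n 2)) * X ^ 2 +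
      C (-4 * (n 0 + n 1 + n 2) *
        ((n 0 + n 1 + n 2) ^ 2 - 4 * (n 0 * n 1 + n 0 * n 2 + n 1 * n 2)) -
          64 * (n 0 * n 1 * n 2)) * X +
      C (((n 0 + n 1 + n 2) ^ 2 - 4 * (n 0 * n 1 + n 0 * n 2 + n 1 * n 2)) ^ 2) := by
  simp only [quartic, C_add, C_sub, C_mul, C_pow, C_neg, C_ofNat]
  ring

theorem monic_quartic (n : Fin 3 → R) : (quartic n).Monic := by
  rw [quartic_eq]
  monicity!

theorem natDegree_quartic [Nontrivial R] (n : Fin 3 → R) : (quartic n).natDegree = 4 := by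
  rw [quartic_eq]
  compute_degree!

theorem eval₂_quartic {S : Type*} [CommRing S] (φ : R →+* S) {n : Fin 3 → R} {a : Fin 3 → S}
    (ha : ∀ i, a i ^ 2 = φ (n i)) : eval₂ φ ((∑ i, a i) ^ 2) (quartic n) = 0 := by
  simp only [quartic, eval₂_sub, eval₂_pow, eval₂_mul, eval₂_C, eval₂_X, Fin.sum_univ_three]
  simp only [map_add, map_mul, map_ofNat, ← ha]
  ring

theorem coeff_quartic_form (a b c d : R) (j : ℕ) :
    (X ^ 4 + C a * X ^ 3 + C b * X ^ 2 + C c * X + C d : R[X]).coeff j =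
      match j with | 0 => d | 1 => c | 2 => b | 3 => a | 4 => 1 | _ => 0 := by
  simp only [coeff_add, coeff_C_mul, coeff_X_pow, coeff_X, coeff_C]
  match j with
  | 0 | 1 | 2 | 3 | 4 | k + 5 => simp

theorem coeff_quartic_three (n : Fin 3 → R) : (quartic n).coeff 3 = -4 * (n 0 + n 1 + n 2) := by
  rw [quartic_eq]
  exact coeff_quartic_form _ _ _ _ 3

theorem coeff_quartic_two (n : Fin 3 → R) : (quartic n).coeff 2 =
    6 * (n 0 + n 1 + n 2) ^ 2 - 8 * (n 0 * n 1 + n 0 * n 2 + n 1 * n 2) := by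
  rw [quartic_eq]
  exact coeff_quartic_form _ _ _ _ 2

theorem coeff_quartic_one (n : Fin 3 → R) : (quartic n).coeff 1 =
    -4 * (n 0 + n 1 + n 2) *
      ((n 0 + n 1 + n 2) ^ 2 - 4 * (n 0 * n 1 + n 0 * n 2 + n 1 * n 2)) -
        64 * (n 0 * n 1 * n 2) := by
  rw [quartic_eq]
  exact coeff_quartic_form _ _ _ _ 1

theorem coeff_quartic_zero (n : Fin 3 → R) : (quartic n).coeff 0 =
    ((n 0 + n 1 + n 2) ^ 2 - 4 * (n 0 * n 1 + n 0 * n 2 + n 1 * n 2)) ^ 2 := by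
  rw [quartic_eq]
  exact coeff_quartic_form _ _ _ _ 0

theorem exists_eq_of_quartic_eq [IsDomain R] (h2 : (2 : R) ≠ 0) {n n' : Fin 3 → R}
    (h : quartic n = quartic n') (i : Fin 3) : ∃ j, n i = n' j := by
  have c1 := congrArg (fun P => coeff P 1) h
  have c2 := congrArg (fun P => coeff P 2) h
  have c3 := congrArg (fun P => coeff P 3) h
  simp only [coeff_quartic_one, coeff_quartic_two, coeff_quartic_three] at c1 c2 c3
  have e1 : n 0 + n 1 + n 2 = n' 0 + n' 1 + n' 2 :=
    mul_left_cancel₀ (pow_ne_zero 2 h2) (by linear_combination -c3)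
  rw [e1] at c1 c2
  have e2 : n 0 * n 1 + n 0 * n 2 + n 1 * n 2 = n' 0 * n' 1 + n' 0 * n' 2 + n' 1 * n' 2 :=
    mul_left_cancel₀ (pow_ne_zero 3 h2) (by linear_combination -c2)
  rw [e2] at c1
  have e3 : n 0 * n 1 * n 2 = n' 0 * n' 1 * n' 2 :=
    mul_left_cancel₀ (pow_ne_zero 6 h2) (by linear_combination -c1)
  have hprod : (n i - n' 0) * (n i - n' 1) * (n i - n' 2) = 0 := by
    have hn : (n i - n 0) * (n i - n 1) * (n i - n 2) = 0 := by fin_cases i <;> simp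
    linear_combination hn + n i ^ 2 * e1 - n i * e2 + e3
  simp only [mul_eq_zero, sub_eq_zero] at hprod
  obtain (h0 | h1) | h2 := hprod
  exacts [⟨0, h0⟩, ⟨1, h1⟩, ⟨2, h2⟩]

theorem isSquare_of_mul_sq [IsDomain R] [IsIntegrallyClosed R] {c g h : R} (hg : g ≠ 0)
    (hc : c * g ^ 2 = h ^ 2) : IsSquare c := by
  obtain ⟨k, rfl⟩ : g ∣ h :=
    (IsIntegrallyClosed.pow_dvd_pow_iff two_ne_zero).1 ⟨c, by rw [← hc, mul_comm]⟩
  exact ⟨k, mul_right_cancel₀ (pow_ne_zero 2 hg) (by rw [hc]; ring)⟩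

/-- If a depressed quartic is the product of `X² + βX + c` and `X² - βX + c'`, then `β²` is a root
of its cubic resolvent. -/
theorem irreducible_depressed_quartic [IsDomain R] {p q s : R}
    (hroot : ∀ y, y ^ 4 + p * y ^ 2 + q * y + s ≠ 0)
    (hres : ∀ β, β ^ 2 * ((β ^ 2 + p) ^ 2 - 4 * s) ≠ q ^ 2) :
    Irreducible (X ^ 4 + C p * X ^ 2 + C q * X + C s : R[X]) := by
  set D : R[X] := X ^ 4 + C p * X ^ 2 + C q * X + C s with hD
  have hmonic : D.Monic := by rw [hD]; monicity!
  have hdeg : D.natDegree = 4 := by rw [hD]; compute_degree!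
  refine (hmonic.irreducible_iff_natDegree').2 ⟨fun h1 => ?_, fun f g hf hg hfg hgdeg => ?_⟩
  · rw [h1, natDegree_one] at hdeg
    omega
  have hsum : f.natDegree + g.natDegree = 4 := by rw [← hf.natDegree_mul hg, hfg, hdeg]
  rw [hdeg, Finset.mem_Ioc] at hgdeg
  obtain hg1 | hg2 : g.natDegree = 1 ∨ g.natDegree = 2 := by omega
  · have hev : eval (-g.coeff 0) D = 0 := by
      rw [← hfg, eval_mul, hg.eq_X_add_C hg1]
      simp
    exact hroot (-g.coeff 0) (by simpa [hD] using hev)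
  · have hform {h : R[X]} (hm : h.Monic) (hd : h.natDegree = 2) :
        h = X ^ 2 + C (h.coeff 1) * X + C (h.coeff 0) := by
      conv_lhs => rw [hm.as_sum, hd, Finset.sum_range_succ, Finset.sum_range_one]
      ring
    have hprod : f * g = X ^ 4 + C (f.coeff 1 + g.coeff 1) * X ^ 3 +
        C (f.coeff 0 + g.coeff 0 + f.coeff 1 * g.coeff 1) * X ^ 2 +
        C (f.coeff 1 * g.coeff 0 + f.coeff 0 * g.coeff 1) * X + C (f.coeff 0 * g.coeff 0) := by
      conv_lhs => rw [hform hf (by omega), hform hg hg2]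
      simp only [C_add, C_mul]
      ring
    have hcoeff (j : ℕ) := congrArg (fun P => coeff P j) (hprod.symm.trans hfg)
    have hD0 : D = X ^ 4 + C 0 * X ^ 3 + C p * X ^ 2 + C q * X + C s := by simp [hD]
    simp only [hD0, coeff_quartic_form] at hcoeff
    have c0 : f.coeff 0 * g.coeff 0 = s := hcoeff 0
    have c1 : f.coeff 1 * g.coeff 0 + f.coeff 0 * g.coeff 1 = q := hcoeff 1
    have c2 : f.coeff 0 + g.coeff 0 + f.coeff 1 * g.coeff 1 = p := hcoeff 2
    have c3 : g.coeff 1 = -f.coeff 1 := eq_neg_of_add_eq_zero_right (hcoeff 3)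
    rw [c3] at c1 c2
    refine hres (f.coeff 1) ?_
    rw [← c0, ← c1, ← c2]
    ring

theorem eq_neg_two_mul_of_not_isSquare [IsDomain R] [IsIntegrallyClosed R] (h2 : (2 : R) ≠ 0)
    {a b c y : R} (hy : (y ^ 2 - 4 * (a * b + a * c + b * c)) ^ 2 =
      64 * (a * b * c) * (y + (a + b + c))) (hbc : ¬ IsSquare (b * c)) : y = -2 * a := by
  have key : b * c * (y ^ 2 + 4 * (b * c - a * b - a * c)) ^ 2 =
      (4 * (b * c * (y + 2 * a))) ^ 2 := by
    linear_combination (b * c) * hy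
  have hy0 : y ^ 2 + 4 * (b * c - a * b - a * c) = 0 := by
    by_contra hG
    exact hbc (isSquare_of_mul_sq hG key)
  have h4 : (4 : R) ≠ 0 := by simpa [← show (2 : R) * 2 = 4 by norm_num] using h2
  have hbc0 : b * c ≠ 0 := fun h0 => hbc (h0 ▸ IsSquare.zero)
  rw [hy0, zero_pow two_ne_zero, mul_zero, eq_comm, sq_eq_zero_iff, mul_eq_zero_iff_left h4,
    mul_eq_zero_iff_left hbc0] at key
  linear_combination key

theorem irreducible_quartic [IsDomain R] [IsIntegrallyClosed R] (h2 : (2 : R) ≠ 0)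
    {n : Fin 3 → R} (hn : Pairwise fun i j => ¬ IsSquare (n i * n j)) :
    Irreducible (quartic n) := by
  have h01 : ¬ IsSquare (n 0 * n 1) := hn (by decide)
  have h02 : ¬ IsSquare (n 0 * n 2) := hn (by decide)
  have h12 : ¬ IsSquare (n 1 * n 2) := hn (by decide)
  have hshift : algEquivAevalXAddC (n 0 + n 1 + n 2) (quartic n) =
      X ^ 4 + C (-8 * (n 0 * n 1 + n 0 * n 2 + n 1 * n 2)) * X ^ 2 +
        C (-64 * (n 0 * n 1 * n 2)) * X +
        C (16 * (n 0 * n 1 + n 0 * n 2 + n 1 * n 2) ^ 2 -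
          64 * (n 0 * n 1 * n 2) * (n 0 + n 1 + n 2)) := by
    simp only [quartic, algEquivAevalXAddC_apply, map_sub, map_pow, map_mul, map_neg, map_add,
      map_ofNat, aeval_X, aeval_C, Polynomial.algebraMap_eq]
    ring
  rw [← MulEquiv.irreducible_iff (algEquivAevalXAddC (n 0 + n 1 + n 2)), hshift]
  refine irreducible_depressed_quartic (fun y hy => h01 ?_) (fun β hβ => ?_)
  · have hy0 : y = -2 * n 0 :=
      eq_neg_two_mul_of_not_isSquare h2 (b := n 1) (c := n 2) (by linear_combination hy) h12
    have hy1 : y = -2 * n 1 :=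
      eq_neg_two_mul_of_not_isSquare h2 (b := n 0) (c := n 2) (by linear_combination hy) h02
    have h10 : n 0 = n 1 := mul_left_cancel₀ h2 (by linear_combination hy0 - hy1)
    exact ⟨n 1, by rw [h10]⟩
  · have hfac : (n 0 * n 1 * 4 ^ 2 - β ^ 2) * (n 0 * n 2 * 4 ^ 2 - β ^ 2) *
        (n 1 * n 2 * 4 ^ 2 - β ^ 2) = 0 := by
      linear_combination -hβ
    have h4 : (4 : R) ≠ 0 := by simpa [← show (2 : R) * 2 = 4 by norm_num] using h2
    simp only [mul_eq_zero, sub_eq_zero] at hfac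
    obtain (h | h) | h := hfac
    exacts [h01 (isSquare_of_mul_sq h4 h), h02 (isSquare_of_mul_sq h4 h),
      h12 (isSquare_of_mul_sq h4 h)]

end Quartic

section WeightedDegree

variable {R : Type*} [CommRing R] {m a b : ℕ} {f g : R[X][X]}

theorem wdeg_sub_le_of_le (hf : wdeg m f ≤ a) (hg : wdeg m g ≤ b) :
    wdeg m (f - g) ≤ max a b := by
  rw [wdeg, map_sub]
  exact natDegree_sub_le_of_le hf hg

theorem wdeg_mul_le_of_le (hf : wdeg m f ≤ a) (hg : wdeg m g ≤ b) : wdeg m (f * g) ≤ a + b := by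
  rw [wdeg, map_mul]
  exact natDegree_mul_le_of_le hf hg

theorem wdeg_pow_le_of_le (k : ℕ) (hf : wdeg m f ≤ a) : wdeg m (f ^ k) ≤ k * a := by
  rw [wdeg, map_pow]
  exact natDegree_pow_le_of_le k hf

theorem wdeg_quartic_le {n : Fin 3 → R[X]} (hn : ∀ i, (n i).natDegree ≤ m) :
    wdeg m (quartic n) ≤ 4 * m := by
  have h₁ : (n 0 + n 1 + n 2).natDegree ≤ m :=
    natDegree_add_le_of_degree_le (natDegree_add_le_of_degree_le (hn 0) (hn 1)) (hn 2)
  have h₂ : (4 * (n 0 * n 1 + n 0 * n 2 + n 1 * n 2)).natDegree ≤ 0 + (m + m) := by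
    refine natDegree_mul_le_of_le (natDegree_ofNat 4).le
      (natDegree_add_le_of_degree_le (natDegree_add_le_of_degree_le ?_ ?_) ?_) <;>
      exact natDegree_mul_le_of_le (hn _) (hn _)
  have h₃ : (64 * (n 0 * n 1 * n 2)).natDegree ≤ 0 + (m + m + m) :=
    natDegree_mul_le_of_le (natDegree_ofNat 64).le
      (natDegree_mul_le_of_le (natDegree_mul_le_of_le (hn 0) (hn 1)) (hn 2))
  have hX : wdeg m (X : R[X][X]) ≤ m := by simpa using wdeg_X_pow_le (R := R) (m := m) 1
  rw [← wdeg_C (m := m)] at h₁ h₂ h₃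
  have hsq := wdeg_sub_le_of_le (wdeg_pow_le_of_le 2 (wdeg_sub_le_of_le hX h₁)) h₂
  refine (wdeg_sub_le_of_le (wdeg_pow_le_of_le 2 hsq) (wdeg_mul_le_of_le h₃ hX)).trans ?_
  omega

end WeightedDegree

section RationalSpan

variable {R M : Type*} [CommRing R] [AddCommGroup M] [Module R M] {v w : M}

/-- The elements of a module which are proportional to `v` over the total ring of fractions. -/
def rationalSpan (R : Type*) {M : Type*} [CommRing R] [AddCommGroup M] [Module R M] (v : M) :
    Submodule R M :=
  (Submodule.torsion R (M ⧸ Submodule.span R {v})).comap (Submodule.span R {v}).mkQ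

theorem mem_rationalSpan :
    w ∈ rationalSpan R v ↔ ∃ a ∈ nonZeroDivisors R, ∃ b : R, a • w = b • v := by
  simp only [rationalSpan, Submodule.mem_comap, Submodule.mem_torsion_iff, Subtype.exists,
    Submonoid.mk_smul, Submodule.mkQ_apply, ← Submodule.Quotient.mk_smul,
    Submodule.Quotient.mk_eq_zero, Submodule.mem_span_singleton, exists_prop, @eq_comm M (_ • v)]

theorem self_mem_rationalSpan (v : M) : v ∈ rationalSpan R v :=
  mem_rationalSpan.2 ⟨1, one_mem _, 1, rfl⟩

end RationalSpan

section Lattice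

theorem linearIndependent_of_coeff_twist {R ι : Type*} [CommRing R] [Finite ι] {m s : ℕ}
    {h : ι → R[X][X]} (hs : ∀ i, wdeg m (h i) ≤ s)
    (hli : LinearIndependent R fun i => (twist R m (h i)).coeff s) : LinearIndependent R[X] h := by
  have := Fintype.ofFinite ι
  rw [Fintype.linearIndependent_iff]
  intro c hc i
  have : Nonempty ι := ⟨i⟩
  obtain ⟨i₀, -, hmax⟩ :=
    Finset.exists_max_image Finset.univ (fun i => (c i).natDegree) Finset.univ_nonempty
  have htop : ∑ i, (c i).coeff (c i₀).natDegree • (twist R m (h i)).coeff s = 0 := by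
    have h0 := congrArg (fun f => (twist R m f).coeff ((c i₀).natDegree + s)) hc
    simp only [map_sum, finsetSum_coeff, smul_eq_C_mul, map_mul, twist_C, map_zero,
      coeff_zero] at h0
    rw [← h0]
    refine Finset.sum_congr rfl fun i _ => ?_
    rw [coeff_mul_add_eq_of_natDegree_le (natDegree_map_le.trans (hmax i (Finset.mem_univ i)))
      (hs i), coeff_map, smul_eq_C_mul]
  have hcoeff := Fintype.linearIndependent_iff.1 hli _ htop
  have hi₀ : c i₀ = 0 := leadingCoeff_eq_zero.1 (hcoeff i₀)
  have hi := hmax i (Finset.mem_univ i)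
  rw [hi₀, natDegree_zero, Nat.le_zero] at hi
  rw [eq_C_of_natDegree_eq_zero hi, ← C_0]
  simpa [hi₀] using congrArg C (hcoeff i)

variable {K L : Type*} [Field K] [Field L] {φ : K[X] →+* L} {z : L} {n m r s : ℕ}

/-- The polynomials in `X` over `K[T]` of degree less than `n` and of weighted degree less than `s`
which vanish at `z`. -/
noncomputable def shortRelations (φ : K[X] →+* L) (z : L) (n m s : ℕ) : Submodule K K[X][X] :=
  (degreeLT K[X] n).restrictScalars K ⊓
    ((degreeLT K[X] s).restrictScalars K).comap (twist K m).toLinearMap ⊓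
    (RingHom.ker (eval₂RingHom φ z)).restrictScalars K

theorem mem_shortRelations {f : K[X][X]} : f ∈ shortRelations φ z n m s ↔
    (f.degree < n ∧ (twist K m f).degree < s) ∧ eval₂ φ z f = 0 := by
  simp [shortRelations, mem_degreeLT]

theorem mem_shortRelations_of_ne_zero {f : K[X][X]} (hf : f ≠ 0) : f ∈ shortRelations φ z n m s ↔
    (f.natDegree < n ∧ wdeg m f < s) ∧ eval₂ φ z f = 0 := by
  rw [mem_shortRelations, wdeg, natDegree_lt_iff_degree_lt hf,
    natDegree_lt_iff_degree_lt (twist_ne_zero hf)]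

theorem shortRelations_mono : Monotone (shortRelations φ z n m) := by
  intro s s' h f hf
  rw [mem_shortRelations] at hf ⊢
  exact ⟨⟨hf.1.1, hf.1.2.trans_le (by exact_mod_cast h)⟩, hf.2⟩

instance : Module.Finite K (shortRelations φ z n m s) := by
  let coeffs : shortRelations φ z n m s →ₗ[K] (Fin n → Fin s → K) :=
    LinearMap.pi fun j => LinearMap.pi fun t => lcoeff K t ∘ₗ
      (lcoeff K[X] j).restrictScalars K ∘ₗ (shortRelations φ z n m s).subtype
  refine Module.Finite.of_injective coeffs ((injective_iff_map_eq_zero _).2 fun f hf => ?_)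
  by_contra hne
  obtain ⟨⟨hn, hs⟩, -⟩ := (mem_shortRelations_of_ne_zero fun h => hne (Subtype.ext h)).1 f.2
  refine hne (Subtype.ext (Polynomial.ext fun j => ?_))
  by_contra hj
  have hle := natDegree_coeff_add_le_wdeg (m := m) f.1 hj
  refine hj (leadingCoeff_eq_zero.1 ?_)
  exact congrFun (congrFun hf ⟨j, (le_natDegree_of_ne_zero hj).trans_lt hn⟩)
    ⟨(f.1.coeff j).natDegree, by omega⟩

theorem finrank_shortRelations_succ_lt (hφ : Set.InjOn φ (shortPolys K r)) (hn : 0 < n)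
    (hs : n * s < r + m * ∑ j : Fin n, (j : ℕ)) :
    Module.finrank K (shortRelations φ z n m (s + 1)) <
      Module.finrank K (shortRelations φ z n m s) + n := by
  let top : shortRelations φ z n m (s + 1) →ₗ[K] K[X] :=
    (lcoeff K[X] s).restrictScalars K ∘ₗ (twist K m).toLinearMap ∘ₗ Submodule.subtype _
  have hker : Module.finrank K (LinearMap.ker top) ≤
      Module.finrank K (shortRelations φ z n m s) := by
    rw [← Submodule.finrank_map_subtype_eq]
    refine Submodule.finrank_mono ?_
    rintro _ ⟨⟨f, hf⟩, h0, rfl⟩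
    rw [mem_shortRelations] at hf
    refine mem_shortRelations.2 ⟨⟨hf.1.1, (degree_lt_iff_coeff_zero _ _).2 fun t ht => ?_⟩, hf.2⟩
    obtain rfl | hlt := ht.eq_or_lt
    · exact h0
    · exact (degree_lt_iff_coeff_zero _ _).1 hf.1.2 t hlt
  have hrange : Module.finrank K (LinearMap.range top) < n := by
    by_contra! hle
    obtain ⟨p, hp⟩ := exists_linearIndependent_of_le_finrank hle
    choose h hh using fun i => (p i).2
    have hcoeff : LinearIndependent K fun i => (twist K m (h i).1).coeff s := by
      have hp' := hp.map' (LinearMap.range top).subtype (Submodule.ker_subtype _)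
      rwa [show (LinearMap.range top).subtype ∘ p = fun i => (twist K m (h i).1).coeff s from
        funext fun i => (hh i).symm] at hp'
    have hne (i : Fin n) : (h i).1 ≠ 0 := fun h0 => hcoeff.ne_zero i (by simp [h0])
    have hmem (i : Fin n) := (mem_shortRelations_of_ne_zero (hne i)).1 (h i).2
    have hwdeg (i : Fin n) : wdeg m (h i).1 ≤ s := Nat.lt_succ_iff.1 (hmem i).1.2
    have key := add_le_sum_wdeg (m := m) hφ hn (linearIndependent_of_coeff_twist hwdeg hcoeff)
      (fun i => (hmem i).1.1) (fun i => (hmem i).2)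
    have hle := Finset.sum_le_card_nsmul Finset.univ _ s fun i _ => hwdeg i
    rw [Finset.card_univ, Fintype.card_fin, smul_eq_mul] at hle
    omega
  have hadd := LinearMap.finrank_range_add_finrank_ker (K := K)
    (V := shortRelations φ z n m (s + 1)) top
  omega

theorem finrank_shortRelations_inf_lt {W : Submodule K[X] K[X][X]} {v : K[X][X]} (hv : v ≠ 0)
    (hvW : v ∈ W) (hvn : v.natDegree < n) (hvs : wdeg m v ≤ s) (hvz : eval₂ φ z v = 0) :
    Module.finrank K (shortRelations φ z n m s ⊓ W.restrictScalars K : Submodule K K[X][X]) <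
      Module.finrank K
        (shortRelations φ z n m (s + 1) ⊓ W.restrictScalars K : Submodule K K[X][X]) := by
  have : Module.Finite K
      (shortRelations φ z n m (s + 1) ⊓ W.restrictScalars K : Submodule K K[X][X]) :=
    Submodule.finiteDimensional_of_le inf_le_left
  refine Submodule.finrank_lt_finrank_of_lt (lt_of_le_not_ge
    (inf_le_inf_right _ (shortRelations_mono s.le_succ)) fun hle => ?_)
  have hC : (C (X ^ (s - wdeg m v)) : K[X][X]) ≠ 0 := C_ne_zero.2 (pow_ne_zero _ X_ne_zero)
  have hne : C (X ^ (s - wdeg m v)) * v ≠ 0 := mul_ne_zero hC hv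
  have hwdeg : wdeg m (C (X ^ (s - wdeg m v)) * v) = s := by
    rw [wdeg_mul hC hv, wdeg_C, natDegree_X_pow, Nat.sub_add_cancel hvs]
  have hmem : C (X ^ (s - wdeg m v)) * v ∈ shortRelations φ z n m (s + 1) := by
    rw [mem_shortRelations_of_ne_zero hne, hwdeg, natDegree_mul hC hv, natDegree_C, zero_add,
      eval₂_mul, hvz, mul_zero]
    exact ⟨⟨hvn, s.lt_succ_self⟩, rfl⟩
  have hW : C (X ^ (s - wdeg m v)) * v ∈ W := by
    rw [← smul_eq_C_mul]
    exact W.smul_mem _ hvW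
  have hlt := ((mem_shortRelations_of_ne_zero hne).1 (hle ⟨hmem, hW⟩).1).1.2
  omega

theorem finrank_shortRelations_add_le (hφ : Set.InjOn φ (shortPolys K r))
    {W : Submodule K[X] K[X][X]} {v : K[X][X]} (hv : v ≠ 0) (hvW : v ∈ W) (hvn : v.natDegree < n)
    (hvs : wdeg m v ≤ s) (hvz : eval₂ φ z v = 0)
    (hW : shortRelations φ z n m s ≤ W.restrictScalars K) (k : ℕ)
    (hk : n * (s + k) < r + n + m * ∑ j : Fin n, (j : ℕ)) :
    Module.finrank K (shortRelations φ z n m (s + k)) + 2 * k ≤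
      Module.finrank K
        (shortRelations φ z n m (s + k) ⊓ W.restrictScalars K : Submodule K K[X][X]) + n * k := by
  induction k with
  | zero => rw [add_zero, inf_eq_left.2 hW, mul_zero, mul_zero]
  | succ k ih =>
    rw [← add_assoc, mul_add_one] at hk
    rw [← add_assoc, mul_add_one, mul_add_one]
    have hV := finrank_shortRelations_succ_lt (φ := φ) (z := z) (m := m) (s := s + k) hφ
      (Nat.zero_lt_of_lt hvn) (by omega)
    have hinf := finrank_shortRelations_inf_lt (φ := φ) (z := z) hv hvW hvn
      (hvs.trans (Nat.le_add_right s k)) hvz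
    have := ih (by omega)
    omega

end Lattice

section LineIntersection

/-- The equation `(4c₂ - c₃²)² = 64c₀` satisfied by the coefficients of the polynomials `quartic n`,
as a function of the polynomial: it vanishes on these. -/
noncomputable def quarticDefect {R : Type*} [CommRing R] (f : R[X]) : R :=
  (4 * f.coeff 2 - f.coeff 3 ^ 2) ^ 2 - 64 * f.coeff 0

theorem quarticDefect_quartic {R : Type*} [CommRing R] (n : Fin 3 → R) :
    quarticDefect (quartic n) = 0 := by
  rw [quarticDefect, coeff_quartic_two, coeff_quartic_three, coeff_quartic_zero]
  ring

theorem quarticDefect_map {R S : Type*} [CommRing R] [CommRing S] (φ : R →+* S) (f : R[X]) :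
    quarticDefect (f.map φ) = φ (quarticDefect f) := by
  simp only [quarticDefect, coeff_map, map_sub, map_mul, map_pow, map_ofNat]

theorem exists_natDegree_le_four_of_quarticDefect_eq_zero {k : Type*} [CommRing k] [IsDomain k]
    (h2 : (2 : k) ≠ 0) (f : k[X]) {v : k[X]}
    (hv : ¬ (v.coeff 0 = 0 ∧ v.coeff 2 = 0 ∧ v.coeff 3 = 0)) :
    ∃ p : k[X], p ≠ 0 ∧ p.natDegree ≤ 4 ∧ ∀ t, quarticDefect (f + C t * v) = 0 → p.IsRoot t := by
  set a₀ := 4 * f.coeff 2 - f.coeff 3 ^ 2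
  set a₁ := 4 * v.coeff 2 - 2 * f.coeff 3 * v.coeff 3 with ha₁
  refine ⟨C (v.coeff 3 ^ 4) * X ^ 4 + C (-2 * a₁ * v.coeff 3 ^ 2) * X ^ 3 +
    C (a₁ ^ 2 - 2 * a₀ * v.coeff 3 ^ 2) * X ^ 2 + C (2 * a₀ * a₁ - 64 * v.coeff 0) * X +
    C (a₀ ^ 2 - 64 * f.coeff 0), fun hp => hv ?_, by compute_degree, fun t ht => ?_⟩
  · have hcoeff (j : ℕ) := congrArg (fun p => coeff p j) hp
    simp only [coeff_add, coeff_C_mul, coeff_X_pow, coeff_X, coeff_C, coeff_zero] at hcoeff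
    have hv3 : v.coeff 3 = 0 := by simpa using hcoeff 4
    have ha₁0 : a₁ = 0 := by simpa [hv3] using hcoeff 2
    have hv0 : 64 * v.coeff 0 = 0 := by simpa [ha₁0] using hcoeff 1
    have hv2 : 4 * v.coeff 2 = 0 := by linear_combination ha₁0 - ha₁ + 2 * f.coeff 3 * hv3
    rw [show (64 : k) = 2 ^ 6 by norm_num] at hv0
    rw [show (4 : k) = 2 ^ 2 by norm_num] at hv2
    exact ⟨(mul_eq_zero_iff_left (pow_ne_zero 6 h2)).1 hv0,
      (mul_eq_zero_iff_left (pow_ne_zero 2 h2)).1 hv2, hv3⟩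
  · simp only [quarticDefect, coeff_add, coeff_C_mul] at ht
    simp only [IsRoot.def, eval_add, eval_mul, eval_C, eval_X_pow, eval_X]
    linear_combination ht

theorem exists_map_eq_C_mul_map {R : Type*} [CommRing R] [IsDomain R] {v w : R[X]}
    (h : w ∈ rationalSpan R v) :
    ∃ t : FractionRing R, w.map (algebraMap R (FractionRing R)) =
      C t * v.map (algebraMap R (FractionRing R)) := by
  obtain ⟨a, ha, b, hab⟩ := mem_rationalSpan.1 h
  have ha' : algebraMap R (FractionRing R) a ≠ 0 :=
    IsFractionRing.to_map_ne_zero_of_mem_nonZeroDivisors ha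
  refine ⟨algebraMap R _ b / algebraMap R _ a, Polynomial.ext fun j => ?_⟩
  have hj := congrArg (fun f => algebraMap R (FractionRing R) (coeff f j)) hab
  simp only [coeff_smul, smul_eq_mul, map_mul] at hj
  rw [coeff_C_mul, coeff_map, coeff_map, div_mul_eq_mul_div, eq_div_iff ha', mul_comm, hj]

/-- A line which is not parallel to the coordinate axis of the coefficient `c₁` meets the surface
`(4c₂ - c₃²)² = 64c₀` in at most four points. -/
theorem card_le_four_of_sub_mem_rationalSpan {R : Type*} [CommRing R] [IsDomain R]
    (h2 : (2 : R) ≠ 0) {v : R[X]} (hv : ¬ (v.coeff 0 = 0 ∧ v.coeff 2 = 0 ∧ v.coeff 3 = 0))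
    {P : Finset R[X]} (hP : ∀ f ∈ P, quarticDefect f = 0)
    (hline : ∀ f ∈ P, ∀ g ∈ P, f - g ∈ rationalSpan R v) : P.card ≤ 4 := by
  classical
  obtain rfl | ⟨g, hg⟩ := P.eq_empty_or_nonempty
  · simp
  set ι : R →+* FractionRing R := algebraMap R (FractionRing R)
  have hι : Function.Injective ι := IsFractionRing.injective R (FractionRing R)
  have h2' : (2 : FractionRing R) ≠ 0 := by
    rw [← map_ofNat ι 2]
    exact (map_ne_zero_iff ι hι).2 h2
  obtain ⟨p, hp0, hp4, hp⟩ := exists_natDegree_le_four_of_quarticDefect_eq_zero h2' (g.map ι)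
    (v := v.map ι) (by simpa only [coeff_map, map_eq_zero_iff ι hι] using hv)
  choose! t ht using fun f (hf : f ∈ P) => exists_map_eq_C_mul_map (hline f hf g hg)
  have hmap {f : R[X]} (hf : f ∈ P) : f.map ι = g.map ι + C (t f) * v.map ι := by
    rw [← ht f hf, Polynomial.map_sub, add_sub_cancel]
  have hroot : Set.MapsTo t P p.roots.toFinset := by
    intro f hf
    rw [SetLike.mem_coe, Multiset.mem_toFinset, mem_roots hp0]
    exact hp _ (by rw [← hmap hf, quarticDefect_map, hP f hf, map_zero])
  have hinj : Set.InjOn t P := fun f hf f' hf' h =>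
    map_injective ι hι (by rw [hmap hf, hmap hf', h])
  calc P.card ≤ p.roots.toFinset.card := Finset.card_le_card_of_injOn t hroot hinj
    _ ≤ p.roots.card := Multiset.toFinset_card_le _
    _ ≤ 4 := (card_roots' p).trans hp4

end LineIntersection

theorem card_le_mul_pow_of_finrank_le {K E : Type*} [Field K] [Finite K] [AddCommGroup E]
    [Module K E] {V W : Submodule K E} [Module.Finite K V] {e n : ℕ}
    (h : Module.finrank K V ≤ Module.finrank K (V ⊓ W : Submodule K E) + e) {P : Finset E}
    (hP : ∀ x ∈ P, ∀ y ∈ P, x - y ∈ V)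
    (hn : ∀ Q ⊆ P, (∀ x ∈ Q, ∀ y ∈ Q, x - y ∈ W) → Q.card ≤ n) :
    P.card ≤ n * Nat.card K ^ e := by
  classical
  obtain rfl | ⟨x₀, hx₀⟩ := P.eq_empty_or_nonempty
  · simp
  set U : Submodule K V := W.submoduleOf V
  have hU : Module.finrank K U = Module.finrank K (V ⊓ W : Submodule K E) := by
    rw [← Submodule.map_comap_subtype, Submodule.finrank_map_subtype_eq]
    rfl
  have hquot : Module.finrank K (V ⧸ U) ≤ e := by
    have := Submodule.finrank_quotient_add_finrank U
    omega
  have : Finite (V ⧸ U) := Module.finite_of_finite K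
  choose! y hy using fun x (hx : x ∈ P) => (⟨⟨x - x₀, hP x hx x₀ hx₀⟩, rfl⟩ : ∃ y : V, y = x - x₀)
  have hfibre {x x' : E} (hx : x ∈ P) (hx' : x' ∈ P) (h : U.mkQ (y x) = U.mkQ (y x')) :
      x - x' ∈ W := by
    have hsub : (y x - y x' : E) ∈ W := (Submodule.Quotient.eq U).1 h
    rwa [hy x hx, hy x' hx', sub_sub_sub_cancel_right] at hsub
  calc P.card ≤ n * (P.image fun x => U.mkQ (y x)).card := by
        refine Finset.card_le_mul_card_image _ _ fun c _ => hn _ (Finset.filter_subset _ _) ?_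
        intro x hx x' hx'
        rw [Finset.mem_filter] at hx hx'
        exact hfibre hx.1 hx'.1 (hx.2.trans hx'.2.symm)
    _ ≤ n * Nat.card (V ⧸ U) := by
        rw [← Set.ncard_coe_finset]
        exact Nat.mul_le_mul_left _ (Set.ncard_le_card _)
    _ ≤ n * Nat.card K ^ e := by
        rw [Module.natCard_eq_pow_finrank (K := K)]
        exact Nat.mul_le_mul_left _ (Nat.pow_le_pow_right Nat.card_pos hquot)

section CubicRelations

variable {K L : Type*} [Field K] [Field L] {φ : K[X] →+* L} {z : L} {m r e : ℕ} {D v w : K[X][X]}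

theorem mem_rationalSpan_of_natDegree_eq_zero {R : Type*} [CommRing R] [IsDomain R] {v w g : R[X]}
    (hv : v ≠ 0) (hv0 : v.natDegree = 0) (hw0 : w.natDegree = 0) :
    g * w ∈ rationalSpan R (g * v) := by
  rw [eq_C_of_natDegree_eq_zero hv0] at hv ⊢
  rw [eq_C_of_natDegree_eq_zero hw0]
  refine mem_rationalSpan.2 ⟨v.coeff 0, mem_nonZeroDivisors_of_ne_zero (C_ne_zero.1 hv),
    w.coeff 0, ?_⟩
  simp only [smul_eq_C_mul]
  ring

/-- The common factor `g` of `v` and `w` does not vanish at `z`, since it is coprime to `D`, so the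
coprime cofactors do. -/
theorem mem_rationalSpan_of_irreducible_quartic (hφ : Set.InjOn φ (shortPolys K r))
    (hr : 12 * m < r) (hD : Irreducible D) (hD4 : D.natDegree = 4) (hDm : wdeg m D ≤ 4 * m)
    (hDz : eval₂ φ z D = 0) (hv : v ≠ 0) (hw : w ≠ 0) (hv4 : v.natDegree < 4)
    (hw4 : w.natDegree < 4) (hvm : wdeg m v ≤ 4 * m) (hwm : wdeg m w ≤ 4 * m)
    (hvz : eval₂ φ z v = 0) (hwz : eval₂ φ z w = 0)
    (hvw : 3 * wdeg m v + 3 * wdeg m w < r + 9 * m) : w ∈ rationalSpan K[X] v := by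
  obtain ⟨v', w', g, hrel, rfl, rfl⟩ := UniqueFactorizationMonoid.exists_reduced_factors v hv w
  have hg : g ≠ 0 := left_ne_zero_of_mul hv
  have hv' : v' ≠ 0 := right_ne_zero_of_mul hv
  have hw' : w' ≠ 0 := right_ne_zero_of_mul hw
  rw [wdeg_mul hg hv'] at hvm hvw
  rw [wdeg_mul hg hw'] at hwm hvw
  rw [natDegree_mul hg hv'] at hv4
  rw [natDegree_mul hg hw'] at hw4
  rw [eval₂_mul] at hvz hwz
  have hv'm : v'.natDegree * m ≤ wdeg m v' := natDegree_mul_le_wdeg v'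
  have hw'm : w'.natDegree * m ≤ wdeg m w' := natDegree_mul_le_wdeg w'
  by_contra hnot
  have hpos : 0 < v'.natDegree + w'.natDegree := by
    by_contra h0
    exact hnot (mem_rationalSpan_of_natDegree_eq_zero hv' (by omega) (by omega))
  have hgz : eval₂ φ z g ≠ 0 := by
    intro hgz
    have hDg : IsRelPrime D g := hD.isRelPrime_iff_not_dvd.2 fun h => by
      have := natDegree_le_of_dvd h hg
      omega
    have key := add_mul_le_of_isRelPrime (m := m) hφ hD.ne_zero hg hDg (by omega) hDz hgz
    rw [hD4] at key
    have hm : m ≤ max (wdeg m v') (wdeg m w') := by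
      obtain hpos | hpos : 0 < v'.natDegree ∨ 0 < w'.natDegree := Nat.add_pos_iff_pos_or_pos.1 hpos
      · exact le_max_of_le_left ((Nat.le_mul_of_pos_left m hpos).trans hv'm)
      · exact le_max_of_le_right ((Nat.le_mul_of_pos_left m hpos).trans hw'm)
    have hle := Nat.mul_le_mul_left g.natDegree hDm
    rw [mul_left_comm, mul_comm _ m] at hle
    rw [mul_left_comm] at key
    omega
  have key := add_mul_le_of_isRelPrime (m := m) hφ hv' hw' hrel hpos
    ((mul_eq_zero.1 hvz).resolve_left hgz) ((mul_eq_zero.1 hwz).resolve_left hgz)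
  have hv'3 : v'.natDegree ≤ 3 := by omega
  have hw'3 : w'.natDegree ≤ 3 := by omega
  generalize v'.natDegree = a at *
  generalize w'.natDegree = b at *
  interval_cases a <;> interval_cases b <;> omega

theorem coeff_ne_zero_of_eval₂_eq_zero (hφ : Set.InjOn φ (shortPolys K r)) (hz : z ≠ 0)
    (hv : v ≠ 0) (hv4 : v.natDegree < 4) (hvr : wdeg m v < r) (hvz : eval₂ φ z v = 0) :
    ¬ (v.coeff 0 = 0 ∧ v.coeff 2 = 0 ∧ v.coeff 3 = 0) := by
  rintro ⟨h0, h2, h3⟩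
  rw [eval₂_eq_sum_range' φ hv4] at hvz
  simp only [Finset.sum_range_succ, Finset.range_zero, Finset.sum_empty, h0, h2, h3, map_zero,
    zero_mul, zero_add, add_zero, mul_eq_zero, pow_one, hz, or_false] at hvz
  have h1 : v.coeff 1 ≠ 0 := fun h1 => hv <| Polynomial.ext fun j => by
    match j with
    | 0 | 1 | 2 | 3 => simpa
    | j + 4 => exact coeff_eq_zero_of_natDegree_lt (by omega)
  have hle := natDegree_coeff_add_le_wdeg (m := m) v h1
  have hr := le_natDegree_of_map_eq_zero hφ hvz h1
  omega

theorem exists_finrank_shortRelations_le (hφ : Set.InjOn φ (shortPolys K r)) (hr : 12 * m < r)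
    (he : 15 * m < r + 6 * e) (hz : z ≠ 0) (hD : Irreducible D) (hD4 : D.natDegree = 4)
    (hDm : wdeg m D ≤ 4 * m) (hDz : eval₂ φ z D = 0) :
    ∃ v : K[X][X], ¬ (v.coeff 0 = 0 ∧ v.coeff 2 = 0 ∧ v.coeff 3 = 0) ∧
      Module.finrank K (shortRelations φ z 4 m (4 * m + 1)) ≤ Module.finrank K
        (shortRelations φ z 4 m (4 * m + 1) ⊓ (rationalSpan K[X] v).restrictScalars K :
          Submodule K K[X][X]) + 2 * e := by
  by_cases hbot : shortRelations φ z 4 m (4 * m + 1) = ⊥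
  · exact ⟨1, by simp, by rw [hbot, finrank_bot]; exact Nat.zero_le _⟩
  obtain ⟨f, hf, hf0⟩ := Submodule.exists_mem_ne_zero_of_ne_bot hbot
  obtain ⟨v, ⟨hvmem, hv⟩, hvmin⟩ := exists_minimalFor_of_wellFoundedLT
    (fun f => f ∈ shortRelations φ z 4 m (4 * m + 1) ∧ f ≠ 0) (wdeg m) ⟨f, hf, hf0⟩
  have hmin {f : K[X][X]} (hf : f ∈ shortRelations φ z 4 m (4 * m + 1)) (hf0 : f ≠ 0) :
      wdeg m v ≤ wdeg m f := (le_total _ _).elim id (hvmin ⟨hf, hf0⟩)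
  obtain ⟨⟨hv4, hvm⟩, hvz⟩ := (mem_shortRelations_of_ne_zero hv).1 hvmem
  obtain ⟨s, hs⟩ : ∃ s, s = max (4 * m + 1 - e) (wdeg m v) := ⟨_, rfl⟩
  have hspan : shortRelations φ z 4 m s ≤ (rationalSpan K[X] v).restrictScalars K := by
    intro w hw
    obtain rfl | hw0 := eq_or_ne w 0
    · exact zero_mem _
    have hvw := hmin (shortRelations_mono (by omega) hw) hw0
    obtain ⟨⟨hw4, hwm⟩, hwz⟩ := (mem_shortRelations_of_ne_zero hw0).1 hw
    exact mem_rationalSpan_of_irreducible_quartic hφ hr hD hD4 hDm hDz hv hw0 hv4 hw4 (by omega)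
      (by omega) hvz hwz (by omega)
  refine ⟨v, coeff_ne_zero_of_eval₂_eq_zero hφ hz hv hv4 (hvm.trans_le (by omega)) hvz, ?_⟩
  have hle := finrank_shortRelations_add_le hφ hv (self_mem_rationalSpan v) hv4 (by omega) hvz hspan
    (4 * m + 1 - s) (by rw [show ∑ j : Fin 4, (j : ℕ) = 6 from rfl]; omega)
  rw [show s + (4 * m + 1 - s) = 4 * m + 1 by omega] at hle
  omega

theorem quartic_sub_quartic_mem_shortRelations {n n' : Fin 3 → K[X]}
    (hn : ∀ i, (n i).natDegree ≤ m) (hn' : ∀ i, (n' i).natDegree ≤ m)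
    (hz : eval₂ φ z (quartic n) = 0) (hz' : eval₂ φ z (quartic n') = 0) :
    quartic n - quartic n' ∈ shortRelations φ z 4 m (4 * m + 1) := by
  have hdeg (n : Fin 3 → K[X]) : (quartic n).degree = (4 : ℕ) := by
    rw [degree_eq_natDegree (monic_quartic n).ne_zero, natDegree_quartic]
  have hwdeg := wdeg_sub_le_of_le (wdeg_quartic_le hn) (wdeg_quartic_le hn')
  refine mem_shortRelations.2 ⟨⟨?_, ?_⟩, by rw [eval₂_sub, hz, hz', sub_zero]⟩
  · rw [← hdeg n]
    exact degree_sub_lt_left (by rw [hdeg, hdeg]) (monic_quartic n).ne_zero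
      (by rw [(monic_quartic n).leadingCoeff, (monic_quartic n').leadingCoeff])
  · rw [max_self] at hwdeg
    exact degree_le_natDegree.trans_lt (by exact_mod_cast Nat.lt_succ_of_le hwdeg)

theorem polynomial_two_ne_zero {R : Type*} [Semiring R] (h2 : (2 : R) ≠ 0) : (2 : R[X]) ≠ 0 := by
  rw [← C_ofNat]
  exact C_ne_zero.2 h2

theorem card_quartic_le [Finite K] (h2 : (2 : K) ≠ 0) (hφ : Set.InjOn φ (shortPolys K r))
    (hr : 12 * m < r) (he : 15 * m < r + 6 * e) (hz : z ≠ 0) {P : Finset K[X][X]}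
    (hP : ∀ D ∈ P, ∃ n : Fin 3 → K[X], (∀ i, (n i).natDegree ≤ m) ∧
      (Pairwise fun i j => ¬ IsSquare (n i * n j)) ∧ eval₂ φ z (quartic n) = 0 ∧ D = quartic n) :
    P.card ≤ 4 * Nat.card K ^ (2 * e) := by
  obtain rfl | ⟨D₀, hD₀⟩ := P.eq_empty_or_nonempty
  · simp
  have h2' := polynomial_two_ne_zero h2
  obtain ⟨n₀, hn₀, hsep, hz₀, -⟩ := hP D₀ hD₀
  obtain ⟨v, hv, hrank⟩ := exists_finrank_shortRelations_le hφ hr he hz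
    (irreducible_quartic h2' hsep) (natDegree_quartic n₀) (wdeg_quartic_le hn₀) hz₀
  refine card_le_mul_pow_of_finrank_le hrank (fun D hD D' hD' => ?_) fun Q hQ hline =>
    card_le_four_of_sub_mem_rationalSpan h2' hv (fun D hD => ?_) hline
  · obtain ⟨n, hn, -, hnz, rfl⟩ := hP D hD
    obtain ⟨n', hn', -, hnz', rfl⟩ := hP D' hD'
    exact quartic_sub_quartic_mem_shortRelations hn hn' hnz hnz'
  · obtain ⟨n, -, -, -, rfl⟩ := hP D (hQ hD)
    exact quarticDefect_quartic n

end CubicRelations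

section Energy

variable {G ι : Type*} [DecidableEq G]

/-- The number of representations of `g` by the family `f` over `S`. -/
def reps (S : Finset ι) (f : ι → G) (g : G) : ℕ :=
  (S.filter fun i => f i = g).card

/-- The additive energy of the family `f` over `S`, that is, the number of pairs on which `f` takes
equal values. -/
def energy [Fintype G] (S : Finset ι) (f : ι → G) : ℕ :=
  ∑ g, reps S f g ^ 2

theorem sum_reps [Fintype G] (S : Finset ι) (f : ι → G) : ∑ g, reps S f g = S.card :=
  (Finset.card_eq_sum_card_fiberwise fun _ _ => Finset.mem_coe.2 (Finset.mem_univ _)).symm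

theorem energy_le_of_reps_le [Fintype G] {S : Finset ι} {f : ι → G} {B : ℕ}
    (h : ∀ g, reps S f g ≤ B) : energy S f ≤ B * S.card := by
  rw [← sum_reps S f, Finset.mul_sum]
  refine Finset.sum_le_sum fun g _ => ?_
  rw [sq]
  exact Nat.mul_le_mul_right _ (h g)

theorem card_filter_product_eq_energy [Fintype G] (S : Finset ι) (f : ι → G) :
    ((S ×ˢ S).filter fun p => f p.1 = f p.2).card = energy S f := by
  rw [Finset.card_eq_sum_card_fiberwise (f := fun p => f p.1) (t := Finset.univ)
    fun _ _ => Finset.mem_coe.2 (Finset.mem_univ _)]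
  refine Finset.sum_congr rfl fun g _ => ?_
  rw [reps, sq, ← Finset.card_product]
  congr 1
  ext p
  simp only [Finset.mem_filter, Finset.mem_product]
  grind

theorem reps_product_add [AddCommGroup G] (S : Finset ι) (f : ι → G) (X : Finset G) (g : G) :
    reps (S ×ˢ X) (fun p => f p.1 + p.2) g = ∑ x ∈ X, reps S f (g - x) := by
  classical
  simp only [reps, Finset.card_filter, Finset.sum_product_right, eq_sub_iff_add_eq]

theorem energy_product_add_le [AddCommGroup G] [Fintype G] (S : Finset ι) (f : ι → G)
    (X : Finset G) : energy (S ×ˢ X) (fun p => f p.1 + p.2) ≤ X.card ^ 2 * energy S f := by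
  calc energy (S ×ˢ X) (fun p => f p.1 + p.2)
      = ∑ g, (∑ x ∈ X, reps S f (g - x)) ^ 2 := by
        refine Finset.sum_congr rfl fun g _ => ?_
        rw [reps_product_add]
    _ ≤ ∑ g, X.card * ∑ x ∈ X, reps S f (g - x) ^ 2 :=
        Finset.sum_le_sum fun g _ => sq_sum_le_card_mul_sum_sq
    _ = X.card * ∑ x ∈ X, ∑ g, reps S f (g - x) ^ 2 := by
        rw [← Finset.mul_sum, Finset.sum_comm]
    _ = X.card * ∑ _x ∈ X, energy S f := by
        congr 1
        refine Finset.sum_congr rfl fun x _ => ?_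
        exact Equiv.sum_comp (Equiv.subRight x) (fun g => reps S f g ^ 2)
    _ = X.card ^ 2 * energy S f := by
        rw [Finset.sum_const, smul_eq_mul]
        ring

theorem energy_union_le [Fintype G] [DecidableEq ι] (A B : Finset ι) (f : ι → G) :
    energy (A ∪ B) f ≤ 2 * (energy A f + energy B f) := by
  rw [energy, energy, energy, ← Finset.sum_add_distrib, Finset.mul_sum]
  refine Finset.sum_le_sum fun g _ => ?_
  have hle : reps (A ∪ B) f g ≤ reps A f g + reps B f g := by
    rw [reps, Finset.filter_union]
    exact Finset.card_union_le _ _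
  exact (Nat.pow_le_pow_left hle 2).trans (add_sq_le)

variable [AddCommGroup G] [Fintype G]

/-- The additive energy of the sums of `k` elements of `X`, that is, the number of solutions in `X`
of the equation `x₁ + ⋯ + xₖ = xₖ₊₁ + ⋯ + x₂ₖ`. -/
def sumEnergy (X : Finset G) (k : ℕ) : ℕ :=
  energy (Fintype.piFinset fun _ : Fin k => X) fun x => ∑ i, x i

theorem sumEnergy_succ_le (X : Finset G) (k : ℕ) :
    sumEnergy X (k + 1) ≤ X.card ^ 2 * sumEnergy X k := by
  refine le_of_eq_of_le (Finset.sum_congr rfl fun g _ => congrArg (· ^ 2) ?_)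
    (energy_product_add_le _ _ X)
  rw [reps, reps]
  refine Finset.card_equiv
    ((Fin.snocEquiv fun _ : Fin (k + 1) => G).symm.trans (Equiv.prodComm _ _)) fun x => ?_
  simp only [Finset.mem_filter, Fintype.mem_piFinset, Finset.mem_product, Fin.forall_fin_succ',
    Fin.sum_univ_castSucc]
  rfl

theorem sumEnergy_add_le (X : Finset G) (k l : ℕ) :
    sumEnergy X (k + l) ≤ X.card ^ (2 * l) * sumEnergy X k := by
  induction l with
  | zero => simp
  | succ l ih =>
    calc sumEnergy X (k + l + 1) ≤ X.card ^ 2 * sumEnergy X (k + l) := sumEnergy_succ_le X _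
      _ ≤ X.card ^ 2 * (X.card ^ (2 * l) * sumEnergy X k) := Nat.mul_le_mul_left _ ih
      _ = X.card ^ (2 * (l + 1)) * sumEnergy X k := by ring

theorem sumEnergy_one_le (X : Finset G) : sumEnergy X 1 ≤ X.card := by
  have hle (g : G) : reps (Fintype.piFinset fun _ : Fin 1 => X) (fun x => ∑ i, x i) g ≤ 1 := by
    refine Finset.card_le_one.2 fun x hx y hy => funext fun i => ?_
    simp only [Finset.mem_filter, Fin.sum_univ_one] at hx hy
    rw [Subsingleton.elim i 0, hx.2, hy.2]
  refine (energy_le_of_reps_le hle).trans_eq ?_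
  rw [one_mul, Fintype.card_piFinset_const, pow_one]

end Energy

section PairFibres

variable {G : Type*}

theorem card_le_of_exists_pair_mem [DecidableEq G] {k n : ℕ} {B : Finset (Fin k → G)}
    {Q : Finset (G × G)} (hB : ∀ x ∈ B, ∃ i j, i ≠ j ∧ (x i, x j) ∈ Q)
    (hn : ∀ i j, i ≠ j → ∀ p, (B.filter fun x => (x i, x j) = p).card ≤ n) :
    B.card ≤ k ^ 2 * (Q.card * n) := by
  let fibre (ij : Fin k × Fin k) := B.filter fun x => ij.1 ≠ ij.2 ∧ (x ij.1, x ij.2) ∈ Q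
  have hfibre (ij) : (fibre ij).card ≤ Q.card * n := by
    obtain hij | hij := eq_or_ne ij.1 ij.2
    · simp [fibre, hij]
    rw [mul_comm]
    refine Finset.card_le_mul_card_image_of_maps_to (f := fun x => (x ij.1, x ij.2))
      (fun x hx => (Finset.mem_filter.1 hx).2.2) n fun p _ => ?_
    exact (Finset.card_le_card (Finset.filter_subset_filter _ (Finset.filter_subset _ _))).trans
      (hn _ _ hij p)
  calc B.card ≤ (Finset.univ.biUnion fibre).card := by
        refine Finset.card_le_card fun x hx => ?_
        obtain ⟨i, j, hx'⟩ := hB x hx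
        exact Finset.mem_biUnion.2 ⟨(i, j), Finset.mem_univ _, Finset.mem_filter.2 ⟨hx, hx'⟩⟩
    _ ≤ Fintype.card (Fin k × Fin k) * (Q.card * n) :=
        Finset.card_biUnion_le_card_mul _ _ _ fun ij _ => hfibre ij
    _ = k ^ 2 * (Q.card * n) := by rw [Fintype.card_prod, Fintype.card_fin, sq]

theorem card_le_of_exists_pair_mem_fin_two {B : Finset (Fin 2 → G)} {Q : Finset (G × G)}
    (hB : ∀ x ∈ B, ∃ i j, i ≠ j ∧ (x i, x j) ∈ Q) : B.card ≤ 4 * Q.card := by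
  classical
  refine (card_le_of_exists_pair_mem hB (n := 1) fun i j hij p => ?_).trans_eq (by ring)
  refine Finset.card_le_one.2 fun x hx y hy => funext fun l => ?_
  have hxy := Prod.mk.inj ((Finset.mem_filter.1 hx).2.trans (Finset.mem_filter.1 hy).2.symm)
  obtain rfl | rfl : l = i ∨ l = j := by omega
  exacts [hxy.1, hxy.2]

theorem exists_univ_fin_three_eq {i j : Fin 3} (h : i ≠ j) :
    ∃ l, l ≠ i ∧ l ≠ j ∧ Finset.univ = {l, i, j} := by
  decide +revert

theorem card_le_of_exists_pair_mem_fin_three {B : Finset (Fin 3 → G)} {X : Finset G}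
    {Q : Finset (G × G)} (hX : B ⊆ Fintype.piFinset fun _ => X)
    (hB : ∀ x ∈ B, ∃ i j, i ≠ j ∧ (x i, x j) ∈ Q) : B.card ≤ 9 * (Q.card * X.card) := by
  classical
  refine card_le_of_exists_pair_mem hB fun i j hij p => ?_
  obtain ⟨l, -, -, huniv⟩ := exists_univ_fin_three_eq hij
  refine Finset.card_le_card_of_injOn (fun x => x l)
    (fun x hx => Fintype.mem_piFinset.1 (hX (Finset.mem_filter.1 hx).1) l) fun x hx y hy hl => ?_
  have hxy := Prod.mk.inj ((Finset.mem_filter.1 hx).2.trans (Finset.mem_filter.1 hy).2.symm)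
  refine funext fun t => ?_
  have ht := huniv ▸ Finset.mem_univ t
  simp only [Finset.mem_insert, Finset.mem_singleton] at ht
  obtain rfl | rfl | rfl := ht
  exacts [hl, hxy.1, hxy.2]

theorem reps_le_of_exists_pair_mem_fin_three [DecidableEq G] [AddCommGroup G]
    {B : Finset (Fin 3 → G)} {Q : Finset (G × G)} (hB : ∀ x ∈ B, ∃ i j, i ≠ j ∧ (x i, x j) ∈ Q)
    (g : G) : reps B (fun x => ∑ i, x i) g ≤ 9 * Q.card := by
  refine (card_le_of_exists_pair_mem (n := 1) (fun x hx => hB x (Finset.mem_filter.1 hx).1)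
    fun i j hij p => ?_).trans_eq (by ring)
  obtain ⟨l, hli, hlj, huniv⟩ := exists_univ_fin_three_eq hij
  refine Finset.card_le_one.2 fun x hx y hy => ?_
  simp only [Finset.mem_filter] at hx hy
  have hxy := Prod.mk.inj (hx.2.trans hy.2.symm)
  have hsum := hx.1.2.trans hy.1.2.symm
  have hli' : l ∉ ({i, j} : Finset (Fin 3)) := by simp [hli, hlj]
  rw [huniv, Finset.sum_insert hli', Finset.sum_insert hli', Finset.sum_pair hij,
    Finset.sum_pair hij, hxy.1, hxy.2] at hsum
  refine funext fun t => ?_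
  have ht := huniv ▸ Finset.mem_univ t
  simp only [Finset.mem_insert, Finset.mem_singleton] at ht
  obtain rfl | rfl | rfl := ht
  exacts [add_right_cancel hsum, hxy.1, hxy.2]

end PairFibres

section Separated

variable {K L : Type*} [Field K] {X : Finset L} {ν : L → K[X]}

open scoped Classical in
/-- The `k`-tuples in `X` to no two entries of which `ν` assigns polynomials in the same square
class. -/
noncomputable def separatedTuples (ν : L → K[X]) (X : Finset L) (k : ℕ) : Finset (Fin k → L) :=
  (Fintype.piFinset fun _ => X).filter fun x : Fin k → L =>
    Pairwise fun i j => ¬ IsSquare (ν (x i) * ν (x j))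

theorem mem_separatedTuples {k : ℕ} {x : Fin k → L} : x ∈ separatedTuples ν X k ↔
    (∀ i, x i ∈ X) ∧ Pairwise fun i j => ¬ IsSquare (ν (x i) * ν (x j)) := by
  classical
  rw [separatedTuples, Finset.mem_filter, Fintype.mem_piFinset]

theorem separatedTuples_subset (ν : L → K[X]) (X : Finset L) (k : ℕ) :
    separatedTuples ν X k ⊆ Fintype.piFinset fun _ => X := by
  classical exact Finset.filter_subset _ _

theorem card_separatedTuples_le (ν : L → K[X]) (X : Finset L) (k : ℕ) :
    (separatedTuples ν X k).card ≤ X.card ^ k :=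
  (Finset.card_le_card (separatedTuples_subset ν X k)).trans_eq (Fintype.card_piFinset_const X k)

open scoped Classical in
/-- The pairs of elements of `X` to which `ν` assigns polynomials in the same square class. -/
noncomputable def squarePairs (ν : L → K[X]) (X : Finset L) : Finset (L × L) :=
  (X ×ˢ X).filter fun p => IsSquare (ν p.1 * ν p.2)

theorem exists_mem_squarePairs [DecidableEq L] {k : ℕ} {x : Fin k → L}
    (hx : x ∈ (Fintype.piFinset fun _ => X) \ separatedTuples ν X k) :
    ∃ i j, i ≠ j ∧ (x i, x j) ∈ squarePairs ν X := by
  rw [Finset.mem_sdiff, Fintype.mem_piFinset, mem_separatedTuples] at hx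
  simpa [Pairwise, squarePairs, hx.1] using hx

/-- `ν` chooses, for every `x ∈ X`, a polynomial of degree less than `m` of which `x` is a modular
square root. -/
def IsSquareLift [Semiring L] (φ : K[X] →+* L) (m : ℕ) (X : Finset L) (ν : L → K[X]) : Prop :=
  ∀ x ∈ X, ν x ∈ shortPolys K m ∧ φ (ν x) = x ^ 2

end Separated

section Fibres

variable {K L : Type*} [Field K] [Field L] {φ : K[X] →+* L} {m r e : ℕ} {X : Finset L}
  {ν : L → K[X]}

theorem natDegree_le_of_mem_shortPolys {n : K[X]} (hn : n ∈ shortPolys K m) : n.natDegree ≤ m :=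
  natDegree_le_of_degree_le (le_of_lt hn)

theorem card_le_of_sq_eq_sq {k : ℕ} {x₀ : Fin (k + 1) → L} {g : L}
    {S : Finset (Fin (k + 1) → L)} (hsq : ∀ x ∈ S, ∀ i, ∃ j, x i ^ 2 = x₀ j ^ 2)
    (hsum : ∀ x ∈ S, ∑ i, x i = g) : S.card ≤ (2 * (k + 1)) ^ k := by
  classical
  set A : Finset L := Finset.univ.image x₀ ∪ Finset.univ.image (-x₀)
  have hA : A.card ≤ 2 * (k + 1) := by
    calc A.card ≤ (Finset.univ.image x₀).card + (Finset.univ.image (-x₀)).card :=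
          Finset.card_union_le _ _
      _ ≤ (k + 1) + (k + 1) := by
          gcongr <;> exact Finset.card_image_le.trans_eq (Finset.card_fin _)
      _ = 2 * (k + 1) := by ring
  have hmaps (x) (hx : x ∈ S) : Fin.init x ∈ Fintype.piFinset fun _ : Fin k => A := by
    refine Fintype.mem_piFinset.2 fun i => Finset.mem_union.2 ?_
    obtain ⟨j, hj⟩ := hsq x hx i.castSucc
    refine (sq_eq_sq_iff_eq_or_eq_neg.1 hj).imp (fun h => ?_) fun h => ?_ <;>
      exact Finset.mem_image.2 ⟨j, Finset.mem_univ j, h.symm⟩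
  have hinj : Set.InjOn Fin.init (S : Set (Fin (k + 1) → L)) := by
    intro x hx y hy hxy
    have hlast := (hsum x hx).trans (hsum y hy).symm
    rw [Fin.sum_univ_castSucc, Fin.sum_univ_castSucc] at hlast
    change ∑ i, Fin.init x i + _ = ∑ i, Fin.init y i + _ at hlast
    rw [hxy] at hlast
    rw [← Fin.snoc_init_self x, ← Fin.snoc_init_self y, hxy, add_left_cancel hlast]
  calc S.card ≤ (Fintype.piFinset fun _ : Fin k => A).card :=
        Finset.card_le_card_of_injOn _ hmaps hinj
    _ = A.card ^ k := by rw [Fintype.card_piFinset_const]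
    _ ≤ (2 * (k + 1)) ^ k := Nat.pow_le_pow_left hA k

theorem natDegree_sub_le_of_natDegree_le {p q : K[X]} {d : ℕ} (hp : p.natDegree ≤ d)
    (hq : q.natDegree ≤ d) : (p - q).natDegree ≤ d :=
  (natDegree_sub_le_of_le hp hq).trans_eq (max_self d)

theorem eq_zero_of_map_mul_eq_map (hφ : Set.InjOn φ (shortPolys K r)) (hr : 4 * m < r)
    {s n A B : K[X]} {z : L} (hn : ¬ IsSquare n) (hs : s.natDegree ≤ m) (hnm : n.natDegree ≤ 2 * m)
    (hA : A.natDegree ≤ m) (hB : B.natDegree ≤ 2 * m) (hz : (z - φ s) ^ 2 = φ n)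
    (hAB : φ A * z = φ B) : A = 0 := by
  have hker : φ ((B - s * A) ^ 2 - n * A ^ 2) = 0 := by
    rw [map_sub, map_pow, map_sub, map_mul, map_mul, map_pow, ← hAB, ← hz]
    ring
  have hdeg : ((B - s * A) ^ 2 - n * A ^ 2).natDegree ≤ 4 * m := by
    refine natDegree_sub_le_of_natDegree_le ?_ ?_
    · exact (natDegree_pow_le_of_le 2 (natDegree_sub_le_of_natDegree_le hB
        ((natDegree_mul_le_of_le hs hA).trans (by omega)))).trans (by omega)
    · exact (natDegree_mul_le_of_le hnm (natDegree_pow_le_of_le 2 hA)).trans (by omega)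
  have heq : n * A ^ 2 = (B - s * A) ^ 2 := by
    by_contra hne
    have := le_natDegree_of_map_eq_zero hφ hker (sub_ne_zero.2 (Ne.symm hne))
    omega
  by_contra hA0
  exact hn (isSquare_of_mul_sq hA0 heq)

/-- Subtracting the monic quadratic equations of `(a + b) ^ 2` and `(a' + b') ^ 2` leaves a linear
equation. -/
theorem add_eq_add_and_mul_eq_mul (h2 : (2 : K) ≠ 0) (hφ : Set.InjOn φ (shortPolys K r))
    (hr : 4 * m < r) {n₁ n₂ n₁' n₂' : K[X]} (h₁ : n₁.natDegree ≤ m) (h₂ : n₂.natDegree ≤ m)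
    (h₁' : n₁'.natDegree ≤ m) (h₂' : n₂'.natDegree ≤ m) (hsep : ¬ IsSquare (n₁ * n₂))
    {a b a' b' : L} (ha : φ n₁ = a ^ 2) (hb : φ n₂ = b ^ 2) (ha' : φ n₁' = a' ^ 2)
    (hb' : φ n₂' = b' ^ 2) (hsum : a + b = a' + b') :
    n₁ + n₂ = n₁' + n₂' ∧ n₁ * n₂ = n₁' * n₂' := by
  have h2' := polynomial_two_ne_zero h2
  have hsep' : ¬ IsSquare (n₁ * n₂ * 2 ^ 2) := fun ⟨h, hh⟩ =>
    hsep (isSquare_of_mul_sq h2' (hh.trans (sq h).symm))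
  have hA : 2 * (n₁ + n₂ - (n₁' + n₂')) = 0 := by
    refine eq_zero_of_map_mul_eq_map hφ hr (s := n₁ + n₂) (B := (n₁ - n₂) ^ 2 - (n₁' - n₂') ^ 2)
      (z := (a + b) ^ 2) hsep' (natDegree_add_le_of_degree_le h₁ h₂) ?_ ?_ ?_ ?_ ?_
    · exact (natDegree_mul_le_of_le (natDegree_mul_le_of_le h₁ h₂)
        (natDegree_pow_le_of_le 2 (natDegree_ofNat 2).le)).trans (by omega)
    · exact (natDegree_mul_le_of_le (natDegree_ofNat 2).le (natDegree_sub_le_of_natDegree_le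
        (natDegree_add_le_of_degree_le h₁ h₂) (natDegree_add_le_of_degree_le h₁' h₂'))).trans
        (by omega)
    · exact natDegree_sub_le_of_natDegree_le
        (natDegree_pow_le_of_le 2 (natDegree_sub_le_of_natDegree_le h₁ h₂))
        (natDegree_pow_le_of_le 2 (natDegree_sub_le_of_natDegree_le h₁' h₂'))
    · simp only [map_mul, map_add, map_pow, map_ofNat, ha, hb]
      ring
    · simp only [map_mul, map_sub, map_add, map_pow, map_ofNat, ha, hb, ha', hb']
      linear_combination hsum * (a + b + (a' + b')) *
        ((a + b) ^ 2 + (a' + b') ^ 2 - 2 * (a' ^ 2 + b' ^ 2))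
  have hs : n₁ + n₂ = n₁' + n₂' := sub_eq_zero.1 ((mul_eq_zero.1 hA).resolve_left h2')
  refine ⟨hs, ?_⟩
  have hker : φ (2 * (2 * (n₁ * n₂ - n₁' * n₂'))) = 0 := by
    have hφs : a ^ 2 + b ^ 2 = a' ^ 2 + b' ^ 2 := by
      rw [← ha, ← hb, ← ha', ← hb', ← map_add, ← map_add, hs]
    simp only [map_mul, map_sub, map_ofNat, ha, hb, ha', hb']
    linear_combination (2 * (a * b + a' * b')) *
      ((a + b + (a' + b')) * hsum - hφs)
  have hdeg : (n₁ * n₂ - n₁' * n₂').natDegree ≤ m + m := natDegree_sub_le_of_natDegree_le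
    (natDegree_mul_le_of_le h₁ h₂) (natDegree_mul_le_of_le h₁' h₂')
  by_contra hne
  have hle := le_natDegree_of_map_eq_zero hφ hker
    (mul_ne_zero h2' (mul_ne_zero h2' (sub_ne_zero.2 hne)))
  have := hle.trans (natDegree_mul_le_of_le (natDegree_ofNat 2).le
    (natDegree_mul_le_of_le (natDegree_ofNat 2).le hdeg))
  omega

variable (hν : IsSquareLift φ m X ν)

include hν in
theorem IsSquareLift.mem_pair_neg [DecidableEq L] {x y : L} (hx : x ∈ X) (hy : y ∈ X)
    (hxy : ν x = ν y) : x ∈ ({y, -y} : Finset L) := by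
  rw [Finset.mem_insert, Finset.mem_singleton, ← sq_eq_sq_iff_eq_or_eq_neg, ← (hν x hx).2,
    ← (hν y hy).2, hxy]

include hν in
theorem IsSquareLift.reps_separatedTuples_two_le [DecidableEq L] (h2 : (2 : K) ≠ 0)
    (hφ : Set.InjOn φ (shortPolys K r)) (hr : 4 * m < r) (g : L) :
    reps (separatedTuples ν X 2) (fun x => ∑ i, x i) g ≤ 4 := by
  rw [reps]
  set S := (separatedTuples ν X 2).filter fun x => ∑ i, x i = g
  obtain hS | ⟨x₀, hx₀⟩ := S.eq_empty_or_nonempty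
  · simp [hS]
  have hmem {x : Fin 2 → L} (hx : x ∈ S) := mem_separatedTuples.1 (Finset.mem_filter.1 hx).1
  have hsum {x : Fin 2 → L} (hx : x ∈ S) : ∑ i, x i = g := (Finset.mem_filter.1 hx).2
  have hsum' {x : Fin 2 → L} (hx : x ∈ S) : x 0 + x 1 = g := by rw [← Fin.sum_univ_two, hsum hx]
  have hdeg {x : Fin 2 → L} (hx : x ∈ S) (i) : (ν (x i)).natDegree ≤ m :=
    natDegree_le_of_mem_shortPolys (hν _ ((hmem hx).1 i)).1
  have hsq {x : Fin 2 → L} (hx : x ∈ S) (i) : φ (ν (x i)) = x i ^ 2 := (hν _ ((hmem hx).1 i)).2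
  refine card_le_of_sq_eq_sq (x₀ := x₀) (fun x hx => ?_) fun x hx => hsum hx
  obtain ⟨hadd, hmul⟩ := add_eq_add_and_mul_eq_mul h2 hφ hr (hdeg hx₀ 0) (hdeg hx₀ 1) (hdeg hx 0)
    (hdeg hx 1) ((hmem hx₀).2 zero_ne_one) (hsq hx₀ 0) (hsq hx₀ 1) (hsq hx 0) (hsq hx 1)
    ((hsum' hx₀).trans (hsum' hx).symm)
  have hroot : ∀ i, (ν (x i) - ν (x₀ 0)) * (ν (x i) - ν (x₀ 1)) = 0 :=
    Fin.forall_fin_two.2 ⟨by linear_combination (-ν (x 0)) * hadd + hmul,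
      by linear_combination (-ν (x 1)) * hadd + hmul⟩
  intro i
  rw [← hsq hx]
  obtain h | h := mul_eq_zero.1 (hroot i)
  · exact ⟨0, by rw [sub_eq_zero.1 h, hsq hx₀]⟩
  · exact ⟨1, by rw [sub_eq_zero.1 h, hsq hx₀]⟩

/-- Otherwise `n 2 - n 0 - n 1` is a square root of `4 * n 0 * n 1`. -/
theorem sum_ne_zero_of_not_isSquare (h2 : (2 : K) ≠ 0) (hφ : Set.InjOn φ (shortPolys K r))
    (hr : 2 * m < r) {n : Fin 3 → K[X]} {a : Fin 3 → L} (hn : ∀ i, (n i).natDegree ≤ m)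
    (ha : ∀ i, φ (n i) = a i ^ 2) (hsep : ¬ IsSquare (n 0 * n 1)) : ∑ i, a i ≠ 0 := by
  intro h0
  rw [Fin.sum_univ_three] at h0
  have hker : φ ((n 2 - n 0 - n 1) ^ 2 - n 0 * n 1 * 2 ^ 2) = 0 := by
    simp only [map_sub, map_mul, map_pow, map_ofNat, ha]
    linear_combination (a 0 + a 1 - a 2) * (a 0 - a 1 + a 2) * (a 0 - a 1 - a 2) * h0
  have hdeg : ((n 2 - n 0 - n 1) ^ 2 - n 0 * n 1 * 2 ^ 2).natDegree ≤ 2 * m := by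
    refine natDegree_sub_le_of_natDegree_le ?_ ?_
    · exact natDegree_pow_le_of_le 2 (natDegree_sub_le_of_natDegree_le
        (natDegree_sub_le_of_natDegree_le (hn 2) (hn 0)) (hn 1))
    · exact (natDegree_mul_le_of_le (natDegree_mul_le_of_le (hn 0) (hn 1))
        (natDegree_pow_le_of_le 2 (natDegree_ofNat 2).le)).trans (by omega)
  have heq : n 0 * n 1 * 2 ^ 2 = (n 2 - n 0 - n 1) ^ 2 := by
    by_contra hne
    have := le_natDegree_of_map_eq_zero hφ hker (sub_ne_zero.2 (Ne.symm hne))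
    omega
  exact hsep (isSquare_of_mul_sq (polynomial_two_ne_zero h2) heq)

include hν in
theorem IsSquareLift.reps_separatedTuples_three_le [Finite K] [DecidableEq L] (h2 : (2 : K) ≠ 0)
    (hφ : Set.InjOn φ (shortPolys K r)) (hr : 12 * m < r) (he : 15 * m < r + 6 * e) (g : L) :
    reps (separatedTuples ν X 3) (fun x => ∑ i, x i) g ≤ 144 * Nat.card K ^ (2 * e) := by
  classical
  rw [reps]
  set S := (separatedTuples ν X 3).filter fun x => ∑ i, x i = g
  obtain hS | ⟨x₀, hx₀⟩ := S.eq_empty_or_nonempty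
  · simp [hS]
  have hmem {x : Fin 3 → L} (hx : x ∈ S) := mem_separatedTuples.1 (Finset.mem_filter.1 hx).1
  have hsum {x : Fin 3 → L} (hx : x ∈ S) : ∑ i, x i = g := (Finset.mem_filter.1 hx).2
  have hdeg {x : Fin 3 → L} (hx : x ∈ S) (i) : (ν (x i)).natDegree ≤ m :=
    natDegree_le_of_mem_shortPolys (hν _ ((hmem hx).1 i)).1
  have hsq {x : Fin 3 → L} (hx : x ∈ S) (i) : φ (ν (x i)) = x i ^ 2 := (hν _ ((hmem hx).1 i)).2
  have hg : g ≠ 0 := hsum hx₀ ▸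
    sum_ne_zero_of_not_isSquare h2 hφ (by omega) (hdeg hx₀) (hsq hx₀) ((hmem hx₀).2 (by decide))
  calc S.card ≤ 36 * (S.image fun x => quartic (ν ∘ x)).card := by
        refine Finset.card_le_mul_card_image _ _ fun D hD => ?_
        obtain ⟨x₁, hx₁, rfl⟩ := Finset.mem_image.1 hD
        refine card_le_of_sq_eq_sq (x₀ := x₁) (g := g) (fun x hx i => ?_)
          fun x hx => hsum (Finset.mem_filter.1 hx).1
        obtain ⟨hx, hxx₁⟩ := Finset.mem_filter.1 hx
        obtain ⟨j, hj⟩ := exists_eq_of_quartic_eq (polynomial_two_ne_zero h2) hxx₁ i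
        exact ⟨j, by rw [← hsq hx, ← hsq hx₁]; exact congrArg φ hj⟩
    _ ≤ 36 * (4 * Nat.card K ^ (2 * e)) := by
        refine Nat.mul_le_mul_left _
          (card_quartic_le h2 hφ hr he (pow_ne_zero 2 hg) fun D hD => ?_)
        obtain ⟨x, hx, rfl⟩ := Finset.mem_image.1 hD
        refine ⟨ν ∘ x, hdeg hx, (hmem hx).2, ?_, rfl⟩
        rw [← hsum hx]
        exact eval₂_quartic φ fun i => (hsq hx i).symm
    _ = 144 * Nat.card K ^ (2 * e) := by ring

theorem sumEnergy_le_energy_separatedTuples [DecidableEq L] [Fintype L] (ν : L → K[X])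
    (X : Finset L) (k : ℕ) :
    sumEnergy X k ≤ 2 * (energy (separatedTuples ν X k) (fun x => ∑ i, x i) +
      energy ((Fintype.piFinset fun _ => X) \ separatedTuples ν X k) fun x => ∑ i, x i) := by
  refine le_of_eq_of_le ?_ (energy_union_le _ _ _)
  rw [sumEnergy, Finset.union_sdiff_of_subset (separatedTuples_subset ν X k)]

include hν in
theorem IsSquareLift.sumEnergy_two_le [Fintype L] [DecidableEq L] (h2 : (2 : K) ≠ 0)
    (hφ : Set.InjOn φ (shortPolys K r)) (hr : 4 * m < r) :
    sumEnergy X 2 ≤ 8 * X.card ^ 2 + 32 * (squarePairs ν X).card ^ 2 := by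
  set B := (Fintype.piFinset fun _ : Fin 2 => X) \ separatedTuples ν X 2
  have hB : B.card ≤ 4 * (squarePairs ν X).card :=
    card_le_of_exists_pair_mem_fin_two fun x hx => exists_mem_squarePairs hx
  calc sumEnergy X 2 ≤ 2 * (energy (separatedTuples ν X 2) (fun x => ∑ i, x i) +
        energy B fun x => ∑ i, x i) := sumEnergy_le_energy_separatedTuples ν X 2
    _ ≤ 2 * (4 * (separatedTuples ν X 2).card + B.card * B.card) := by
        gcongr
        · exact energy_le_of_reps_le (hν.reps_separatedTuples_two_le h2 hφ hr)
        · exact energy_le_of_reps_le fun g => Finset.card_filter_le _ _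
    _ ≤ 2 * (4 * X.card ^ 2 + 4 * (squarePairs ν X).card * (4 * (squarePairs ν X).card)) := by
        gcongr
        exact card_separatedTuples_le ν X 2
    _ = 8 * X.card ^ 2 + 32 * (squarePairs ν X).card ^ 2 := by ring

include hν in
theorem IsSquareLift.sumEnergy_three_le [Finite K] [Fintype L] [DecidableEq L] (h2 : (2 : K) ≠ 0)
    (hφ : Set.InjOn φ (shortPolys K r)) (hr : 12 * m < r) (he : 15 * m < r + 6 * e) :
    sumEnergy X 3 ≤ 288 * Nat.card K ^ (2 * e) * X.card ^ 3 +
      162 * ((squarePairs ν X).card ^ 2 * X.card) := by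
  set B := (Fintype.piFinset fun _ : Fin 3 => X) \ separatedTuples ν X 3
  have hpair (x) (hx : x ∈ B) := exists_mem_squarePairs hx
  have hB : B.card ≤ 9 * ((squarePairs ν X).card * X.card) :=
    card_le_of_exists_pair_mem_fin_three Finset.sdiff_subset hpair
  calc sumEnergy X 3 ≤ 2 * (energy (separatedTuples ν X 3) (fun x => ∑ i, x i) +
        energy B fun x => ∑ i, x i) := sumEnergy_le_energy_separatedTuples ν X 3
    _ ≤ 2 * (144 * Nat.card K ^ (2 * e) * (separatedTuples ν X 3).card +
        9 * (squarePairs ν X).card * B.card) := by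
        gcongr
        · exact energy_le_of_reps_le (hν.reps_separatedTuples_three_le h2 hφ hr he)
        · exact energy_le_of_reps_le (reps_le_of_exists_pair_mem_fin_three hpair)
    _ ≤ 2 * (144 * Nat.card K ^ (2 * e) * X.card ^ 3 +
        9 * (squarePairs ν X).card * (9 * ((squarePairs ν X).card * X.card))) := by
        gcongr
        exact card_separatedTuples_le ν X 3
    _ = _ := by ring

end Fibres

section SquareClasses

variable {K : Type*} [Field K]

theorem mem_shortPolys_succ {m : ℕ} {n : K[X]} :
    n ∈ shortPolys K (m + 1) ↔ n.natDegree ≤ m := by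
  rw [← Nat.lt_succ_iff]
  refine ⟨fun h => ?_, fun h => ?_⟩
  · exact Nat.lt_succ_of_le (natDegree_le_of_degree_le (Order.lt_succ_iff.1 h))
  · exact degree_le_natDegree.trans_lt (by exact_mod_cast h)

theorem exists_eq_C_mul_sq_of_isCoprime {a b : K[X]} (hab : IsCoprime a b)
    (h : IsSquare (a * b)) : ∃ u ≠ 0, ∃ s, a = C u * s ^ 2 := by
  obtain ⟨d, hd⟩ := h
  obtain ⟨s, u, hs⟩ := exists_associated_pow_of_mul_eq_pow' hab (hd.trans (sq d).symm)
  obtain ⟨u₀, hu₀, hu⟩ := Polynomial.isUnit_iff.1 u.isUnit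
  exact ⟨u₀, hu₀.ne_zero, s, by rw [← hs, ← hu, mul_comm]⟩

theorem natDegree_mul_C_mul_sq {c s : K[X]} {u : K} (h : c * (C u * s ^ 2) ≠ 0) :
    (c * (C u * s ^ 2)).natDegree = c.natDegree + 2 * s.natDegree := by
  have hs : C u * s ^ 2 ≠ 0 := right_ne_zero_of_mul h
  rw [natDegree_mul (left_ne_zero_of_mul h) hs, natDegree_C_mul, natDegree_pow]
  rintro rfl
  simp at hs

theorem exists_eq_mul_sq_of_isSquare_mul {a b : K[X]} {d : ℕ} (ha : a.natDegree ≤ d)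
    (hb : b.natDegree ≤ d) (h : IsSquare (a * b)) : ∃ c w s t, a = c * s ^ 2 ∧
      b = C w * c * t ^ 2 ∧ c.natDegree + 2 * s.natDegree ≤ d ∧
        c.natDegree + 2 * t.natDegree ≤ d := by
  obtain rfl | ha0 := eq_or_ne a 0
  · exact ⟨b, 1, 0, 1, by simp, by simp, by simpa using hb, by simpa using hb⟩
  obtain rfl | hb0 := eq_or_ne b 0
  · exact ⟨a, 0, 1, 0, by simp, by simp, by simpa using ha, by simpa using ha⟩
  obtain ⟨a', b', c, hrel, rfl, rfl⟩ := UniqueFactorizationMonoid.exists_reduced_factors a ha0 b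
  have hsq : IsSquare (a' * b') := by
    obtain ⟨e, he⟩ := h
    refine isSquare_of_mul_sq (left_ne_zero_of_mul ha0) (h := e) ?_
    rw [sq e, ← he]
    ring
  obtain ⟨u, hu, s, rfl⟩ := exists_eq_C_mul_sq_of_isCoprime hrel.isCoprime hsq
  obtain ⟨v, -, t, rfl⟩ :=
    exists_eq_C_mul_sq_of_isCoprime hrel.isCoprime.symm (mul_comm (C u * s ^ 2) b' ▸ hsq)
  rw [natDegree_mul_C_mul_sq ha0] at ha
  rw [natDegree_mul_C_mul_sq hb0] at hb
  refine ⟨C u * c, u⁻¹ * v, s, t, by ring, ?_, ?_, ?_⟩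
  · have hinv : (C u⁻¹ * C u : K[X]) = 1 := by rw [← C_mul, inv_mul_cancel₀ hu, C_1]
    rw [C_mul]
    linear_combination (-(c * t ^ 2 * C v)) * hinv
  · rwa [natDegree_C_mul hu]
  · rwa [natDegree_C_mul hu]

end SquareClasses

section Counting

variable {K L : Type*} [Field K] [Finite K] {m : ℕ}

variable (K m) in
theorem card_shortPolys : (finite_shortPolys K m).toFinset.card = Nat.card K ^ m := by
  have hdeg : shortPolys K m = (degreeLT K m : Set K[X]) := Set.ext fun _ => mem_degreeLT.symm
  rw [← Set.ncard_eq_toFinset_card _ (finite_shortPolys K m), hdeg, ← Nat.card_coe_set_eq,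
    SetLike.coe_sort_coe, Nat.card_congr (degreeLTEquiv K m).toEquiv, Nat.card_fun, Nat.card_fin]

theorem card_le_of_isSquare_mul {S : Finset (K[X] × K[X])}
    (hS : ∀ p ∈ S, p.1.natDegree ≤ m ∧ p.2.natDegree ≤ m ∧ IsSquare (p.1 * p.2)) :
    S.card ≤ (m + 1) * Nat.card K ^ (m + 4) := by
  classical
  have := Fintype.ofFinite K
  let A (k : ℕ) : Finset K[X] := (finite_shortPolys K (k + 1)).toFinset
  let T (k : ℕ) : Finset (K[X] × K[X]) :=
    (A k ×ˢ (Finset.univ : Finset K) ×ˢ A ((m - k) / 2) ×ˢ A ((m - k) / 2)).image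
      fun x => (x.1 * x.2.2.1 ^ 2, C x.2.1 * x.1 * x.2.2.2 ^ 2)
  have hmem {k : ℕ} {n : K[X]} (h : n.natDegree ≤ k) : n ∈ A k :=
    (Set.Finite.mem_toFinset _).2 (mem_shortPolys_succ.2 h)
  have hT (k) (hk : k ∈ Finset.range (m + 1)) : (T k).card ≤ Nat.card K ^ (m + 4) := by
    have hkm := Finset.mem_range.1 hk
    refine Finset.card_image_le.trans ?_
    simp only [Finset.card_product, A, card_shortPolys, Finset.card_univ,
      ← Nat.card_eq_fintype_card]
    calc _ = Nat.card K ^ (k + 2 + 2 * ((m - k) / 2 + 1)) := by ring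
      _ ≤ Nat.card K ^ (m + 4) := Nat.pow_le_pow_right Nat.card_pos (by omega)
  have hsub : S ⊆ (Finset.range (m + 1)).biUnion T := by
    rintro ⟨a, b⟩ hp
    obtain ⟨ha, hb, hsq⟩ := hS _ hp
    obtain ⟨c, w, s, t, rfl, rfl, hs, ht⟩ := exists_eq_mul_sq_of_isSquare_mul ha hb hsq
    refine Finset.mem_biUnion.2 ⟨c.natDegree, Finset.mem_range.2 (by omega),
      Finset.mem_image.2 ⟨(c, w, s, t), ?_, rfl⟩⟩
    simp only [Finset.mem_product, Finset.mem_univ, true_and]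
    exact ⟨hmem le_rfl, hmem (by omega), hmem (by omega)⟩
  calc S.card ≤ ((Finset.range (m + 1)).biUnion T).card := Finset.card_le_card hsub
    _ ≤ (Finset.range (m + 1)).card * Nat.card K ^ (m + 4) :=
        Finset.card_biUnion_le_card_mul _ _ _ hT
    _ = (m + 1) * Nat.card K ^ (m + 4) := by rw [Finset.card_range]

variable [Field L] {φ : K[X] →+* L} {X : Finset L} {ν : L → K[X]} (hν : IsSquareLift φ m X ν)

include hν in
theorem IsSquareLift.card_le : X.card ≤ 2 * Nat.card K ^ m := by
  classical
  calc X.card ≤ 2 * (X.image ν).card := by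
        refine Finset.card_le_mul_card_image _ _ fun n hn => ?_
        obtain ⟨y, hy, rfl⟩ := Finset.mem_image.1 hn
        refine (Finset.card_le_card (t := {y, -y}) fun x hx => ?_).trans Finset.card_le_two
        obtain ⟨hx, hxy⟩ := Finset.mem_filter.1 hx
        exact hν.mem_pair_neg hx hy hxy
    _ ≤ 2 * (finite_shortPolys K m).toFinset.card := by
        gcongr
        refine Finset.image_subset_iff.2 fun x hx => ?_
        exact (Set.Finite.mem_toFinset _).2 (hν x hx).1
    _ = 2 * Nat.card K ^ m := by rw [card_shortPolys]

include hν in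
theorem IsSquareLift.card_squarePairs_le :
    (squarePairs ν X).card ≤ 4 * ((m + 1) * Nat.card K ^ (m + 4)) := by
  classical
  have hX {p : L × L} (hp : p ∈ squarePairs ν X) : p.1 ∈ X ∧ p.2 ∈ X :=
    Finset.mem_product.1 (Finset.mem_filter.1 hp).1
  calc (squarePairs ν X).card ≤ 4 * ((squarePairs ν X).image (Prod.map ν ν)).card := by
        refine Finset.card_le_mul_card_image _ _ fun n hn => ?_
        obtain ⟨q, hq, rfl⟩ := Finset.mem_image.1 hn
        calc _ ≤ (({q.1, -q.1} : Finset L) ×ˢ ({q.2, -q.2} : Finset L)).card := by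
              refine Finset.card_le_card fun p hp => Finset.mem_product.2 ?_
              obtain ⟨hp, hpq⟩ := Finset.mem_filter.1 hp
              obtain ⟨h₁, h₂⟩ := Prod.mk.inj hpq
              exact ⟨hν.mem_pair_neg (hX hp).1 (hX hq).1 h₁,
                hν.mem_pair_neg (hX hp).2 (hX hq).2 h₂⟩
          _ ≤ 2 * 2 := by
              rw [Finset.card_product]
              exact Nat.mul_le_mul Finset.card_le_two Finset.card_le_two
    _ ≤ 4 * ((m + 1) * Nat.card K ^ (m + 4)) := by
        refine Nat.mul_le_mul_left _ (card_le_of_isSquare_mul fun n hn => ?_)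
        obtain ⟨p, hp, rfl⟩ := Finset.mem_image.1 hn
        exact ⟨natDegree_le_of_mem_shortPolys (hν _ (hX hp).1).1,
          natDegree_le_of_mem_shortPolys (hν _ (hX hp).2).1, (Finset.mem_filter.1 hp).2⟩

end Counting

section FourfoldEnergy

variable {K L : Type*} [Field K] [Finite K] [Field L] [Fintype L] [DecidableEq L]
  {φ : K[X] →+* L} {m r : ℕ} {X : Finset L} {ν : L → K[X]} (hν : IsSquareLift φ m X ν)

include hν

theorem IsSquareLift.sumEnergy_four_le_pow_seven :
    sumEnergy X 4 ≤ 128 * Nat.card K ^ (7 * m) := by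
  calc sumEnergy X 4 ≤ X.card ^ 6 * sumEnergy X 1 := sumEnergy_add_le X 1 3
    _ ≤ X.card ^ 6 * X.card := Nat.mul_le_mul_left _ (sumEnergy_one_le X)
    _ ≤ (2 * Nat.card K ^ m) ^ 6 * (2 * Nat.card K ^ m) := by gcongr <;> exact hν.card_le
    _ = 128 * Nat.card K ^ (7 * m) := by ring

theorem IsSquareLift.sumEnergy_four_le_pow_six (h2 : (2 : K) ≠ 0)
    (hφ : Set.InjOn φ (shortPolys K r)) (hr : 4 * m < r) :
    sumEnergy X 4 ≤ 8704 * ((m + 1) ^ 2 * Nat.card K ^ 8) * Nat.card K ^ (6 * m) := by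
  have hM : 1 ≤ (m + 1) ^ 2 * Nat.card K ^ 8 :=
    Nat.mul_pos (pow_pos m.succ_pos 2) (pow_pos Nat.card_pos 8)
  calc sumEnergy X 4 ≤ X.card ^ 4 * sumEnergy X 2 := sumEnergy_add_le X 2 2
    _ ≤ X.card ^ 4 * (8 * X.card ^ 2 + 32 * (squarePairs ν X).card ^ 2) :=
        Nat.mul_le_mul_left _ (hν.sumEnergy_two_le h2 hφ hr)
    _ ≤ (2 * Nat.card K ^ m) ^ 4 * (8 * (2 * Nat.card K ^ m) ^ 2 +
        32 * (4 * ((m + 1) * Nat.card K ^ (m + 4))) ^ 2) := by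
        gcongr
        exacts [hν.card_le, hν.card_le, hν.card_squarePairs_le]
    _ = (512 * 1 + 8192 * ((m + 1) ^ 2 * Nat.card K ^ 8)) * Nat.card K ^ (6 * m) := by ring
    _ ≤ (512 * ((m + 1) ^ 2 * Nat.card K ^ 8) + 8192 * ((m + 1) ^ 2 * Nat.card K ^ 8)) *
        Nat.card K ^ (6 * m) := by gcongr
    _ = 8704 * ((m + 1) ^ 2 * Nat.card K ^ 8) * Nat.card K ^ (6 * m) := by ring

theorem IsSquareLift.sumEnergy_four_le_pow_five (h2 : (2 : K) ≠ 0)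
    (hφ : Set.InjOn φ (shortPolys K r)) (hr : 12 * m < r) :
    sumEnergy X 4 ≤ 30000 * ((m + 1) ^ 2 * Nat.card K ^ 8) *
      Nat.card K ^ (5 * m + 2 * ((15 * m - r) / 6)) := by
  set e := (15 * m - r) / 6
  have hM : Nat.card K ^ 2 ≤ (m + 1) ^ 2 * Nat.card K ^ 8 :=
    (Nat.pow_le_pow_right Nat.card_pos (by norm_num)).trans
      (Nat.le_mul_of_pos_left _ (pow_pos m.succ_pos 2))
  calc sumEnergy X 4 ≤ X.card ^ 2 * sumEnergy X 3 := sumEnergy_add_le X 3 1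
    _ ≤ X.card ^ 2 * (288 * Nat.card K ^ (2 * (e + 1)) * X.card ^ 3 +
        162 * ((squarePairs ν X).card ^ 2 * X.card)) :=
        Nat.mul_le_mul_left _ (hν.sumEnergy_three_le h2 hφ hr (by omega))
    _ ≤ (2 * Nat.card K ^ m) ^ 2 *
        (288 * Nat.card K ^ (2 * (e + 1)) * (2 * Nat.card K ^ m) ^ 3 +
          162 * ((4 * ((m + 1) * Nat.card K ^ (m + 4))) ^ 2 * (2 * Nat.card K ^ m))) := by
        gcongr
        exacts [hν.card_le, hν.card_le, hν.card_squarePairs_le, hν.card_le]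
    _ = (9216 * (Nat.card K ^ 2 * Nat.card K ^ (2 * e)) +
        20736 * ((m + 1) ^ 2 * Nat.card K ^ 8 * 1)) * Nat.card K ^ (5 * m) := by ring
    _ ≤ (9264 * ((m + 1) ^ 2 * Nat.card K ^ 8 * Nat.card K ^ (2 * e)) +
        20736 * ((m + 1) ^ 2 * Nat.card K ^ 8 * Nat.card K ^ (2 * e))) *
          Nat.card K ^ (5 * m) := by
        gcongr
        exacts [by norm_num, pow_pos Nat.card_pos _]
    _ = 30000 * ((m + 1) ^ 2 * Nat.card K ^ 8) * Nat.card K ^ (5 * m + 2 * e) := by ring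

theorem IsSquareLift.exists_sumEnergy_four_le (h2 : (2 : K) ≠ 0)
    (hφ : Set.InjOn φ (shortPolys K r)) :
    ∃ n, sumEnergy X 4 ≤ 30000 * ((m + 1) ^ 2 * Nat.card K ^ 8) * Nat.card K ^ n ∧
      (2 * n + r ≤ 23 * m ∨ 4 * n + r ≤ 36 * m ∨ n ≤ 5 * m) := by
  have hM : 1 ≤ (m + 1) ^ 2 * Nat.card K ^ 8 :=
    Nat.mul_pos (pow_pos m.succ_pos 2) (pow_pos Nat.card_pos 8)
  obtain hr | hr | hr : r ≤ 9 * m ∨ (9 * m < r ∧ r ≤ 12 * m) ∨ 12 * m < r := by omega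
  · refine ⟨7 * m, hν.sumEnergy_four_le_pow_seven.trans (Nat.mul_le_mul_right _ ?_), by omega⟩
    omega
  · refine ⟨6 * m, (hν.sumEnergy_four_le_pow_six h2 hφ (by omega)).trans
      (Nat.mul_le_mul_right _ ?_), by omega⟩
    omega
  · exact ⟨_, hν.sumEnergy_four_le_pow_five h2 hφ hr, by omega⟩

end FourfoldEnergy

section Residues

variable {K : Type*} [Field K] {F : K[X]} {m : ℕ}

/-- The representative of `y` modulo `F` of degree less than `deg F`. -/
noncomputable def reduce (F : K[X]) (y : Residues F) : K[X] :=
  Function.surjInv Ideal.Quotient.mk_surjective y % F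

theorem residue_mod (F a : K[X]) : residue F (a % F) = residue F a := by
  rw [EuclideanDomain.mod_eq_sub_mul_div, map_sub, map_mul, Ideal.Quotient.mk_singleton_self,
    zero_mul, sub_zero]

theorem residue_reduce (F : K[X]) (y : Residues F) : residue F (reduce F y) = y :=
  (residue_mod F _).trans (Function.surjInv_eq _ _)

theorem reduce_residue (F a : K[X]) : reduce F (residue F a) = a % F :=
  (residue_eq_iff F _ _).1 (Function.surjInv_eq _ _)

theorem mod_eq_of_mem_shortPolys (hF : F ≠ 0) {a : K[X]} (ha : a ∈ shortPolys K F.natDegree) :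
    a % F = a :=
  (mod_eq_self_iff hF).2 (lt_of_lt_of_eq ha (degree_eq_natDegree hF).symm)

theorem injOn_residue (hF : F ≠ 0) : Set.InjOn (residue F) (shortPolys K F.natDegree) := by
  intro a ha b hb hab
  rw [← mod_eq_of_mem_shortPolys hF ha, ← mod_eq_of_mem_shortPolys hF hb, ← residue_eq_iff, hab]

theorem finite_residues [Finite K] (hF : F ≠ 0) : Finite (Residues F) := by
  refine Set.finite_univ_iff.1 (((finite_shortPolys K F.natDegree).image (residue F)).subset
    fun y _ => ⟨reduce F y, ?_, residue_reduce F y⟩)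
  exact (degree_mod_lt _ hF).trans_eq (degree_eq_natDegree hF)

section ShortRoots

variable [Fintype (Residues F)]

variable (F m) in
open scoped Classical in
/-- The residues modulo `F` whose square is represented by a polynomial of degree less than
`m`. -/
noncomputable def shortRoots : Finset (Residues F) :=
  Finset.univ.filter fun y => reduce F (y ^ 2) ∈ shortPolys K m

theorem mem_shortRoots {y : Residues F} :
    y ∈ shortRoots F m ↔ reduce F (y ^ 2) ∈ shortPolys K m := by
  classical
  rw [shortRoots, Finset.mem_filter, and_iff_right (Finset.mem_univ y)]

theorem isSquareLift_shortRoots :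
    IsSquareLift (residue F) m (shortRoots F m) fun y => reduce F (y ^ 2) := fun y hy =>
  ⟨mem_shortRoots.1 hy, residue_reduce F (y ^ 2)⟩

theorem ncard_le_sumEnergy [DecidableEq (Residues F)] (hF : F ≠ 0) (k m : ℕ) :
    {x ∈ energyTuples F k | ∀ i, degMod F (x i ^ 2) < (m : WithBot ℕ)}.ncard ≤
      sumEnergy (shortRoots F m) k := by
  let e : Fin (k + k) ≃ Fin (2 * k) := finCongr (two_mul k).symm
  have hlt (x : Fin (2 * k) → K[X]) :
      ∑ i with i.val < k, x i = ∑ i : Fin k, x (e (i.castAdd k)) := by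
    simp [Finset.sum_filter, ← e.sum_comp, Fin.sum_univ_add, e]
  have hge (x : Fin (2 * k) → K[X]) :
      ∑ i with k ≤ i.val, x i = ∑ i : Fin k, x (e (i.natAdd k)) := by
    simp [Finset.sum_filter, ← e.sum_comp, Fin.sum_univ_add, e, Nat.not_le_of_lt]
  rw [sumEnergy, ← card_filter_product_eq_energy, ← Set.ncard_coe_finset]
  let ψ (x : Fin (2 * k) → K[X]) : (Fin k → Residues F) × (Fin k → Residues F) :=
    (fun i => residue F (x (e (i.castAdd k))), fun i => residue F (x (e (i.natAdd k))))
  refine Set.ncard_le_ncard_of_injOn ψ ?_ ?_ (Finset.finite_toSet _)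
  · rintro x ⟨⟨-, hsum⟩, hx⟩
    have hmem (i) : residue F (x i) ∈ shortRoots F m := by
      rw [mem_shortRoots, ← map_pow, reduce_residue]
      exact hx i
    rw [hlt, hge, map_sum, map_sum] at hsum
    simpa [ψ, hmem] using hsum
  · rintro x ⟨⟨hx, -⟩, -⟩ y ⟨⟨hy, -⟩, -⟩ hxy
    obtain ⟨h₁, h₂⟩ := Prod.mk.inj hxy
    refine funext fun j => injOn_residue hF (hx j) (hy j) ?_
    obtain ⟨j, rfl⟩ := e.surjective j
    exact j.addCases (fun i => congrFun h₁ i) fun i => congrFun h₂ i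

end ShortRoots

theorem exists_sqrtEnergy_le [Finite K] (h2 : (2 : K) ≠ 0) (hF : Irreducible F) (m : ℕ) :
    ∃ n, sqrtEnergy F 4 (shortWeight ℝ F m) ≤
        30000 * (((m : ℝ) + 1) ^ 2 * (Nat.card K : ℝ) ^ 8) * (Nat.card K : ℝ) ^ n ∧
      (2 * n + F.natDegree ≤ 23 * m ∨ 4 * n + F.natDegree ≤ 36 * m ∨ n ≤ 5 * m) := by
  classical
  have := PrincipalIdealRing.isMaximal_of_irreducible hF
  let := Ideal.Quotient.field (Ideal.span {F})
  have := finite_residues hF.ne_zero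
  let := Fintype.ofFinite (Residues F)
  obtain ⟨n, hle, hn⟩ :=
    isSquareLift_shortRoots.exists_sumEnergy_four_le (m := m) h2 (injOn_residue hF.ne_zero)
  refine ⟨n, ?_, hn⟩
  rw [sqrtEnergy_shortWeight]
  exact_mod_cast (ncard_le_sumEnergy hF.ne_zero 4 m).trans hle

end Residues

section RealExponents

theorem isLittleO_logb_const_mul_sq (b : ℝ) {A : ℝ} (hA : 0 < A) :
    (fun m : ℕ => Real.logb b (A * ((m : ℝ) + 1) ^ 2)) =o[atTop] fun m : ℕ => (m : ℝ) := by
  have heq : (fun m : ℕ => Real.logb b (A * ((m : ℝ) + 1) ^ 2)) = fun m : ℕ =>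
      (Real.log b)⁻¹ * (Real.log A + 2 * Real.log ((m + 1 : ℕ) : ℝ)) := by
    funext m
    have hm : (m : ℝ) + 1 ≠ 0 := by positivity
    rw [Real.logb, Real.log_mul hA.ne' (pow_ne_zero 2 hm), Real.log_pow]
    push_cast
    ring
  rw [heq]
  have hconst : (fun _ : ℕ => Real.log A) =o[atTop] fun m : ℕ => (m : ℝ) :=
    isLittleO_const_left.2 (Or.inr
      (tendsto_norm_atTop_atTop.comp tendsto_natCast_atTop_atTop))
  have hlog : (fun m : ℕ => Real.log ((m + 1 : ℕ) : ℝ)) =o[atTop] fun m : ℕ => (m : ℝ) := by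
    refine (Real.isLittleO_log_id_atTop.comp_tendsto (tendsto_natCast_atTop_atTop.comp
      (tendsto_add_atTop_nat 1))).trans_isBigO (IsBigO.of_bound 2 ?_)
    filter_upwards [eventually_ge_atTop 1] with m hm
    simp only [Function.comp_apply, id_eq, Real.norm_natCast]
    exact_mod_cast (by omega : m + 1 ≤ 2 * m)
  exact (hconst.add (hlog.const_mul_left 2)).const_mul_left _

theorem pow_le_of_exponent_le {q : ℝ} (hq : 1 ≤ q) {m n r : ℕ}
    (h : 2 * n + r ≤ 23 * m ∨ 4 * n + r ≤ 36 * m ∨ n ≤ 5 * m) :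
    q ^ n ≤ q ^ (6 * (m : ℝ)) * (q ^ (11 * (m : ℝ) / 2 - (r : ℝ) / 2) +
      q ^ (3 * (m : ℝ) - (r : ℝ) / 4) + q ^ (5 * (m : ℝ) / 8 - (r : ℝ) / 8)) +
        q ^ (5 * (m : ℝ)) := by
  have hq0 : 0 < q := by linarith
  have hpos (x : ℝ) : 0 < q ^ x := Real.rpow_pos_of_pos hq0 x
  have hle {x : ℝ} (hx : n ≤ x) : q ^ n ≤ q ^ x := by
    rw [← Real.rpow_natCast]
    exact Real.rpow_le_rpow_of_exponent_le hq hx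
  rw [mul_add, mul_add, ← Real.rpow_add hq0, ← Real.rpow_add hq0, ← Real.rpow_add hq0]
  have h₁ := hpos (6 * m + (11 * m / 2 - r / 2))
  have h₂ := hpos (6 * m + (3 * m - r / 4))
  have h₃ := hpos (6 * m + (5 * m / 8 - r / 8))
  have h₄ := hpos (5 * m)
  obtain h | h | h := h
  · have h' : (2 * n + r : ℝ) ≤ 23 * m := by exact_mod_cast h
    linarith [hle (x := 6 * m + (11 * m / 2 - r / 2)) (by linarith)]
  · have h' : (4 * n + r : ℝ) ≤ 36 * m := by exact_mod_cast h
    linarith [hle (x := 6 * m + (3 * m - r / 4)) (by linarith)]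
  · have h' : (n : ℝ) ≤ 5 * m := by exact_mod_cast h
    linarith [hle h']

theorem max_exponent_lt {m r : ℝ} (hm : 0 < m) (hr : m < r / 12) :
    max (6 * m + max (11 * m / 2 - r / 2) (max (3 * m - r / 4) (5 * m / 8 - r / 8))) (5 * m) <
      4 * m + max (7 * m / 2 - r / 2) (2 * m) := by
  have hneg : max (11 * m / 2 - r / 2) (max (3 * m - r / 4) (5 * m / 8 - r / 8)) < 0 :=
    max_lt (by linarith) (max_lt (by linarith) (by linarith))
  have h6 : 6 * m ≤ 4 * m + max (7 * m / 2 - r / 2) (2 * m) := by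
    linarith [le_max_right (7 * m / 2 - r / 2) (2 * m)]
  exact max_lt (by linarith) (by linarith)

end RealExponents

end ModularRoots

theorem theorem2p7 (Fq : Type*) [Field Fq] [Fintype Fq] (hq : Odd (Fintype.card Fq)) :
    (∃ f : ℕ → ℝ, f =o[atTop] (fun m : ℕ => (m : ℝ)) ∧
      ∀ (r m : ℕ) (F : Fq[X]), Irreducible F → F.natDegree = r → m ≤ r →
        ModularRoots.sqrtEnergy F 4 (ModularRoots.shortWeight ℝ F m) ≤
          (Fintype.card Fq : ℝ) ^ (6 * (m : ℝ) + f m) *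
            ((Fintype.card Fq : ℝ) ^ (11 * (m : ℝ) / 2 - (r : ℝ) / 2) +
              (Fintype.card Fq : ℝ) ^ (3 * (m : ℝ) - (r : ℝ) / 4) +
              (Fintype.card Fq : ℝ) ^ (5 * (m : ℝ) / 8 - (r : ℝ) / 8)) +
          (Fintype.card Fq : ℝ) ^ (5 * (m : ℝ) + f m)) ∧
    (∀ r m : ℕ, 0 < m → (m : ℝ) < (r : ℝ) / 12 →
      max (6 * (m : ℝ) + max (11 * (m : ℝ) / 2 - (r : ℝ) / 2)
            (max (3 * (m : ℝ) - (r : ℝ) / 4) (5 * (m : ℝ) / 8 - (r : ℝ) / 8)))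
          (5 * (m : ℝ)) <
        4 * (m : ℝ) + max (7 * (m : ℝ) / 2 - (r : ℝ) / 2) (2 * (m : ℝ))) := by
  refine ⟨?_, fun r m hm hr => ModularRoots.max_exponent_lt (by exact_mod_cast hm) hr⟩
  set q := (Fintype.card Fq : ℝ) with hqdef
  have hq1 : 1 < q := Nat.one_lt_cast.2 Fintype.one_lt_card
  have hq0 : 0 < q := by linarith
  have h2 : (2 : Fq) ≠ 0 := Ring.two_ne_zero fun h =>
    Nat.not_even_iff_odd.2 hq (Nat.even_iff.2 (FiniteField.even_card_iff_char_two.1 h))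
  refine ⟨fun m => Real.logb q (30000 * q ^ 8 * ((m : ℝ) + 1) ^ 2),
    ModularRoots.isLittleO_logb_const_mul_sq q (by positivity), ?_⟩
  rintro r m F hF rfl -
  obtain ⟨n, hle, hn⟩ := ModularRoots.exists_sqrtEnergy_le h2 hF m
  rw [Nat.card_eq_fintype_card, ← hqdef] at hle
  have hlogb : q ^ Real.logb q (30000 * q ^ 8 * ((m : ℝ) + 1) ^ 2) =
      30000 * q ^ 8 * ((m : ℝ) + 1) ^ 2 := Real.rpow_logb hq0 hq1.ne' (by positivity)
  refine (hle.trans (mul_le_mul_of_nonneg_left (ModularRoots.pow_le_of_exponent_le hq1.le hn)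
    (by positivity))).trans_eq ?_
  rw [Real.rpow_add hq0, Real.rpow_add hq0, hlogb]
  ring
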